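/- A matrix $M:[m]\times[n]\to\{0,1\}$ is called a binary matrix; a submatrix of $M$ is a matrix obtained from it by deleting rows and columns while preserving the order of the remaining ones. A matrix property $\mathcal{P}$ is a collection of binary matrices (of all sizes); it is hereditary if it is closed under taking submatrices. For a family $\mathcal{F}$ of binary matrices, $\mathcal{P}_{\mathcal{F}}$ denotes the property of all binary matrices that have no submatrix in $\mathcal{F}$. The family $\mathcal{F}$ is closed under row permutations if every matrix obtained by permuting the rows of a member of $\mathcal{F}$ is again in $\mathcal{F}$. An $m\times n$ matrix $M$ is $\epsilon$-far from $\mathcal{P}$ if every $m\times n$ matrix in $\mathcal{P}$ differs from $M$ in at least $\epsilon mn$ entries. An $\epsilon$-tester for $\mathcal{P}$ is a randomized (possibly adaptive) query algorithm that is given $m,n\ge 1$ and query access to the entries of an $m\times n$ matrix $M$, and that accepts with probability at least $2/3$ if $M\in\mathcal{P}$ and rejects with probability at least $2/3$ if $M$ is $\epsilon$-far from $\mathcal{P}$. It has one-sided error if it accepts with probability $1$ every $M\in\mathcal{P}$. Theorem. Let $\mathcal{P}$ be a hereditary property of binary matrices with $\mathcal{P}=\mathcal{P}_{\mathcal{F}}$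 for some finite family $\mathcal{F}$ that is closed under row permutations. Then $\mathcal{P}$ is easily testable: there is a polynomial $p$, depending only on $\mathcal{P}$, such that for every $\epsilon>0$ there is an $\epsilon$-tester for $\mathcal{P}$ with one-sided error that makes at most $p(\epsilon^{-1})$ queries on every input matrix, whatever its size $m\times n$. -/

import Mathlib

/-- A (finite, two-dimensional, ordered) matrix `M : [m] × [n] → Γ` of some size `m × n`. -/
abbrev FinMatrix (Γ : Type) : Type :=
  Σ (m n : ℕ), Matrix (Fin m) (Fin n) Γ

namespace FinMatrix

variable {Γ : Type}

/-- `A` is obtained from `M` by deleting rows and columns, keeping the order of the others. -/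
def IsSubmatrix (A M : FinMatrix Γ) : Prop :=
  ∃ (f : Fin A.1 ↪o Fin M.1) (g : Fin A.2.1 ↪o Fin M.2.1), M.2.2.submatrix f g = A.2.2

/-- A matrix property is hereditary if it is closed under taking submatrices. -/
def Hereditary (P : Set (FinMatrix Γ)) : Prop :=
  ∀ M ∈ P, ∀ A : FinMatrix Γ, IsSubmatrix A M → A ∈ P

/-- The property of `F`-freeness: no submatrix belongs to the family `F`. -/
def freeness (F : Set (FinMatrix Γ)) : Set (FinMatrix Γ) :=
  {M | ∀ A ∈ F, ¬ IsSubmatrix A M}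

/-- Permuting the rows of a member of `F` in any way gives a member of `F`. -/
def ClosedUnderRowPermutations (F : Set (FinMatrix Γ)) : Prop :=
  ∀ (s t : ℕ) (A : Matrix (Fin s) (Fin t) Γ), (⟨s, t, A⟩ : FinMatrix Γ) ∈ F →
    ∀ σ : Equiv.Perm (Fin s), (⟨s, t, A.submatrix σ id⟩ : FinMatrix Γ) ∈ F

/-- The number of entries in which two matrices of the same size differ. -/
def entryDist [DecidableEq Γ] {m n : ℕ} (M N : Matrix (Fin m) (Fin n) Γ) : ℕ :=
  (Finset.univ.filter fun p : Fin m × Fin n => M p.1 p.2 ≠ N p.1 p.2).card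

/-- `M` is `ε`-far from `P`: at least an `ε`-fraction of the entries of `M` must be changed
to get a matrix (of the same size) in `P`. -/
def IsFar [DecidableEq Γ] (P : Set (FinMatrix Γ)) (ε : ℝ) {m n : ℕ}
    (M : Matrix (Fin m) (Fin n) Γ) : Prop :=
  ∀ N : Matrix (Fin m) (Fin n) Γ, (⟨m, n, N⟩ : FinMatrix Γ) ∈ P →
    ε * ((m : ℝ) * (n : ℝ)) ≤ (entryDist M N : ℝ)

/-- A deterministic, adaptive query algorithm on `m × n` matrices over `Γ`: it either halts
and accepts (`true`) or rejects (`false`), or it queries entry `(i, j)` and continues in a way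
that depends on the entry read. -/
inductive QueryAlg (Γ : Type) (m n : ℕ) : Type
  | halt (accept : Bool) : QueryAlg Γ m n
  | query (i : Fin m) (j : Fin n) (next : Γ → QueryAlg Γ m n) : QueryAlg Γ m n

/-- The output on input `M`. -/
def QueryAlg.output {m n : ℕ} (M : Matrix (Fin m) (Fin n) Γ) : QueryAlg Γ m n → Bool
  | .halt b => b
  | .query i j next => (next (M i j)).output M

/-- The number of queries made on input `M`. -/
def QueryAlg.queries {m n : ℕ} (M : Matrix (Fin m) (Fin n) Γ) : QueryAlg Γ m n → ℕ
  | .halt _ => 0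
  | .query i j next => (next (M i j)).queries M + 1

/-- A probabilistic query algorithm: for every input size `m × n`, a random deterministic
query algorithm on matrices of that size. -/
abbrev RandQueryAlg (Γ : Type) : Type :=
  ∀ m n : ℕ, PMF (QueryAlg Γ m n)

namespace RandQueryAlg

/-- The probability that the algorithm gives the answer `b` on input `M`. -/
noncomputable def outputProb (T : RandQueryAlg Γ) {m n : ℕ} (M : Matrix (Fin m) (Fin n) Γ)
    (b : Bool) : ENNReal :=
  ((T m n).map fun t => t.output M) b

/-- `T` is an `ε`-tester for `P`: on nonempty matrices it distinguishes, with error probability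
at most `1 / 3`, between membership in `P` and being `ε`-far from `P`. -/
def IsTester [DecidableEq Γ] (T : RandQueryAlg Γ) (P : Set (FinMatrix Γ)) (ε : ℝ) : Prop :=
  ∀ m n : ℕ, 0 < m → 0 < n → ∀ M : Matrix (Fin m) (Fin n) Γ,
    ((⟨m, n, M⟩ : FinMatrix Γ) ∈ P → T.outputProb M false ≤ 1 / 3) ∧
    (IsFar P ε M → T.outputProb M true ≤ 1 / 3)

/-- `T` has one-sided error: it always accepts the matrices in `P`. -/
def OneSided (T : RandQueryAlg Γ) (P : Set (FinMatrix Γ)) : Prop :=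
  ∀ m n : ℕ, 0 < m → 0 < n → ∀ M : Matrix (Fin m) (Fin n) Γ,
    (⟨m, n, M⟩ : FinMatrix Γ) ∈ P → T.outputProb M true = 1

/-- `T` makes at most `q` queries, whatever the input, its size and the random choices. -/
def QueriesAtMost (T : RandQueryAlg Γ) (q : ℝ) : Prop :=
  ∀ (m n : ℕ) (M : Matrix (Fin m) (Fin n) Γ), ∀ t ∈ (T m n).support, (t.queries M : ℝ) ≤ q

end RandQueryAlg

/-- `P` is easily testable: for every `ε > 0` it has an `ε`-tester with one-sided error, whose
number of queries is at most a polynomial (that depends only on `P`) in `ε⁻¹`. -/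
def EasilyTestable [DecidableEq Γ] (P : Set (FinMatrix Γ)) : Prop :=
  ∃ p : Polynomial ℝ, ∀ ε : ℝ, 0 < ε →
    ∃ T : RandQueryAlg Γ, T.IsTester P ε ∧ T.OneSided P ∧ T.QueriesAtMost (p.eval ε⁻¹)

end FinMatrix

/-! Read the entries in a random set of rows and columns and reject if a member of `F` occurs there
up to row order. Since `F` is closed under row permutations, every such occurrence is a forbidden
submatrix, so the error is one-sided. It remains to show that, outside an event of small
probability, a sample without a copy certifies an `F`-free matrix that differs from `M` in at most
3/(4e) of the entries, where e = ⌈1/ε⌉.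

By Sauer–Shelah, a copy-free sample has only polynomially many distinct rows on p columns and
distinct columns on r rows (`hasCopy_of_rows`, `hasCopy_of_columns`). Hence sampled rows contain no
large family at pairwise large distance, since random columns would separate it. An exchangeability
argument (`unifProb_uncovered_le`) then shows that a few sampled rows `x` come close to almost all
rows, and that on the rows `x` almost every column equals a sampled one.

The certificate is N i c = M (x (ρ i)) (π c), with ρ choosing a nearby representative and π a
monotone retraction onto the columns that are kept (`exists_close_of_good`). A copy in N must be
pulled back to the sample, against two obstacles. Rows of the copy may share a representative: extra
batches of random rows supply k substitutes for each representative, equal to it outside a small set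
`D` of columns (`rowsGood_of_covered`). And columns must be found in the right order:
`exists_staircase` discards few columns so that each surviving word of column types comes with large
sets of columns, one per letter and in increasing order, all of which random columns are likely to
hit (`columnsGood_of_hits`).

All sample sizes are polynomial in e, and dimensions below the relevant thresholds are read
completely. -/

namespace FinMatrix

/-! ### Uniform probability on finite types -/

section Probability

open Finset

variable {Ω Ω' : Type} [Fintype Ω] [Fintype Ω']

open Classical in
/-- The probability of `p` under the uniform distribution on a finite type. -/
noncomputable def unifProb (p : Ω → Prop) : ℝ :=
  ((univ.filter p).card : ℝ) / (Fintype.card Ω : ℝ)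

theorem unifProb_eq (p : Ω → Prop) [DecidablePred p] :
    unifProb p = ((univ.filter p).card : ℝ) / (Fintype.card Ω : ℝ) := by
  unfold unifProb
  congr

attribute [irreducible] unifProb

theorem unifProb_nonneg (p : Ω → Prop) : 0 ≤ unifProb p := by
  classical
  rw [unifProb_eq]
  positivity

theorem unifProb_mono {p q : Ω → Prop} (h : ∀ ω, p ω → q ω) : unifProb p ≤ unifProb q := by
  classical
  rw [unifProb_eq, unifProb_eq]
  gcongr with ω
  exact h ω

theorem unifProb_or_le (p q : Ω → Prop) :
    unifProb (fun ω => p ω ∨ q ω) ≤ unifProb p + unifProb q := by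
  classical
  rw [unifProb_eq, unifProb_eq, unifProb_eq, ← add_div]
  gcongr
  rw [filter_or]
  exact_mod_cast card_union_le _ _

theorem unifProb_exists_le {ι : Type} [Fintype ι] (p : ι → Ω → Prop) :
    unifProb (fun ω => ∃ i, p i ω) ≤ ∑ i, unifProb (p i) := by
  classical
  simp only [unifProb_eq]
  rw [← sum_div]
  gcongr
  have : (univ.filter fun ω => ∃ i, p i ω) = univ.biUnion fun i => univ.filter (p i) := by
    ext ω; simp
  rw [this]
  exact_mod_cast card_biUnion_le

theorem unifProb_exists_le_mul {ι : Type} [Fintype ι] (p : ι → Ω → Prop) {c : ℝ}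
    (h : ∀ i, unifProb (p i) ≤ c) :
    unifProb (fun ω => ∃ i, p i ω) ≤ Fintype.card ι * c := by
  refine (unifProb_exists_le p).trans ((sum_le_sum fun i _ => h i).trans ?_)
  simp

theorem unifProb_equiv (e : Ω ≃ Ω') (p : Ω' → Prop) :
    unifProb (fun ω => p (e ω)) = unifProb p := by
  classical
  rw [unifProb_eq, unifProb_eq, Fintype.card_congr e]
  congr 2
  exact card_bij (fun a _ => e a) (by simp) (by simp) (fun b hb => ⟨e.symm b, by simpa using hb⟩)

theorem unifProb_prod (p : Ω → Ω' → Prop) :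
    unifProb (fun ω : Ω × Ω' => p ω.1 ω.2) = (∑ a, unifProb (p a)) / Fintype.card Ω := by
  classical
  simp only [unifProb_eq]
  rw [← sum_div, div_div, Fintype.card_prod, mul_comm (Fintype.card Ω), Nat.cast_mul]
  congr 1
  simp only [card_filter, Fintype.sum_prod_type]
  push_cast
  rfl

theorem unifProb_prod_le {p : Ω → Ω' → Prop} {c : ℝ} (hc : 0 ≤ c) (h : ∀ a, unifProb (p a) ≤ c) :
    unifProb (fun ω : Ω × Ω' => p ω.1 ω.2) ≤ c := by
  rw [unifProb_prod]
  refine div_le_of_le_mul₀ (by positivity) hc ((sum_le_sum fun a _ => h a).trans ?_)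
  simp [mul_comm]

theorem unifProb_prod_swap (p : Ω → Ω' → Prop) :
    unifProb (fun ω : Ω × Ω' => p ω.1 ω.2) = unifProb (fun ω : Ω' × Ω => p ω.2 ω.1) := by
  have h := unifProb_equiv (Equiv.prodComm Ω Ω') (fun ω => p ω.2 ω.1)
  simp only [Equiv.prodComm_apply, Prod.fst_swap, Prod.snd_swap] at h
  exact h

theorem unifProb_prod_le' {p : Ω → Ω' → Prop} {c : ℝ} (hc : 0 ≤ c)
    (h : ∀ b, unifProb (fun a => p a b) ≤ c) :
    unifProb (fun ω : Ω × Ω' => p ω.1 ω.2) ≤ c := by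
  rw [unifProb_prod_swap p]
  exact unifProb_prod_le (p := fun b a => p a b) hc h

/-- A map that sends the uniform distribution to the uniform distribution. -/
def Balanced (φ : Ω → Ω') : Prop := ∀ p : Ω' → Prop, unifProb (fun ω => p (φ ω)) = unifProb p

theorem balanced_snd [Nonempty Ω] : Balanced (Prod.snd : Ω × Ω' → Ω') := by
  intro p
  refine (unifProb_prod (fun (_ : Ω) a => p a)).trans ?_
  rw [sum_const, card_univ, nsmul_eq_mul, mul_div_cancel_left₀]
  exact_mod_cast Fintype.card_ne_zero

theorem balanced_fst [Nonempty Ω'] : Balanced (Prod.fst : Ω × Ω' → Ω) := by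
  intro p
  have h := unifProb_prod_swap (fun a (_ : Ω') => p a)
  rw [h]
  exact balanced_snd p

theorem Balanced.comp {Ω'' : Type} [Fintype Ω''] {φ : Ω' → Ω''} {ψ : Ω → Ω'} (hφ : Balanced φ)
    (hψ : Balanced ψ) : Balanced (fun ω => φ (ψ ω)) := fun p => by
  rw [hψ (fun ω => p (φ ω)), hφ]

theorem Balanced.prodMap {A B A' B' : Type} [Fintype A] [Fintype B] [Fintype A'] [Fintype B']
    {φ : A → A'} {ψ : B → B'} (hφ : Balanced φ) (hψ : Balanced ψ) :
    Balanced (fun ω : A × B => (φ ω.1, ψ ω.2)) := fun p => by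
  have h1 : ∀ a, unifProb (fun b => p (φ a, ψ b)) = unifProb fun b => p (φ a, b) :=
    fun a => hψ fun b => p (φ a, b)
  have h2 : ∀ b, unifProb (fun a => p (φ a, b)) = unifProb fun a => p (a, b) :=
    fun b => hφ fun a => p (a, b)
  calc _ = unifProb (fun ω : A × B' => p (φ ω.1, ω.2)) := by
        rw [unifProb_prod (fun a b => p (φ a, ψ b)), unifProb_prod (fun a b => p (φ a, b))]
        simp only [h1]
    _ = unifProb (fun ω : B' × A => p (φ ω.2, ω.1)) :=
        unifProb_prod_swap (fun a b => p (φ a, b))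
    _ = unifProb (fun ω : B' × A' => p (ω.2, ω.1)) := by
        rw [unifProb_prod (fun b a => p (φ a, b)), unifProb_prod (fun b a => p (a, b))]
        simp only [h2]
    _ = unifProb p := unifProb_prod_swap (fun b a => p (a, b))

theorem balanced_eval {ι V : Type} [Fintype ι] [DecidableEq ι] [Fintype V] [Nonempty V] (i : ι) :
    Balanced (fun x : ι → V => x i) := fun p => by
  have h1 := unifProb_equiv (Equiv.funSplitAt i V) (fun ω => p ω.1)
  have h2 := balanced_fst (Ω := V) (Ω' := {j // j ≠ i} → V) p
  rw [← h2, ← h1]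
  rfl

theorem unifProb_eq_const {V : Type} [Fintype V] (c : V) :
    unifProb (fun v => v = c) = 1 / Fintype.card V := by
  classical
  rw [unifProb_eq]
  have : (univ.filter fun v => v = c) = {c} := by ext; simp
  rw [this]
  simp

theorem unifProb_eval_eq {ι V : Type} [Fintype ι] [DecidableEq ι] [Fintype V] [Nonempty V]
    {q : ℕ} (a a' : ι) (h : a ≠ a') (j j' : Fin q) :
    unifProb (fun x : ι → Fin q → V => x a j = x a' j') ≤ 1 / Fintype.card V := by
  have h1 : unifProb (fun x : ι → Fin q → V => x a j = x a' j') =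
      unifProb (fun ω : (Fin q → V) × ({b // b ≠ a} → Fin q → V) =>
        ω.1 j = ω.2 ⟨a', h.symm⟩ j') := by
    rw [← unifProb_equiv (Equiv.funSplitAt a (Fin q → V))]
    rfl
  rw [h1]
  refine unifProb_prod_le' (p := fun (u : Fin q → V) (w : {b // b ≠ a} → Fin q → V) =>
    u j = w ⟨a', h.symm⟩ j') (by positivity) fun w => ?_
  rw [balanced_eval j (fun v => v = w ⟨a', h.symm⟩ j'), unifProb_eq_const]

theorem unifProb_miss_le {V : Type} [Fintype V] [Nonempty V] (p : ℕ) (S : Finset V)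
    {β : ℝ} (hS : β * Fintype.card V ≤ S.card) :
    unifProb (fun x : Fin p → V => ∀ i, x i ∉ S) ≤ Real.exp (-(β * p)) := by
  classical
  have hV : (0 : ℝ) < Fintype.card V := by exact_mod_cast Fintype.card_pos
  have h1 : (univ.filter fun x : Fin p → V => ∀ i, x i ∉ S) = Fintype.piFinset fun _ => Sᶜ := by
    ext x; simp
  have h2 : unifProb (fun x : Fin p → V => ∀ i, x i ∉ S) =
      (((Sᶜ.card : ℕ) : ℝ) / Fintype.card V) ^ p := by
    rw [div_pow, unifProb_eq, h1]
    simp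
  have h3 : ((Sᶜ.card : ℕ) : ℝ) / Fintype.card V ≤ Real.exp (-β) := by
    have : ((Sᶜ.card : ℕ) : ℝ) / Fintype.card V ≤ 1 - β := by
      rw [div_le_iff₀ hV, card_compl, Nat.cast_sub (card_le_univ S)]
      linarith
    linarith [Real.add_one_le_exp (-β)]
  rw [h2]
  calc _ ≤ Real.exp (-β) ^ p := by gcongr
    _ = _ := by rw [← Real.exp_nat_mul]; ring_nf

end Probability

/-! ### Covering by random samples without large cliques -/

section LeaveOneOut

open Finset

/-- Some `N` members of the tuple `x` are pairwise related by `far`. -/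
def HasClique {V ι : Type} (far : V → V → Prop) (N : ℕ) (x : ι → V) : Prop :=
  ∃ e : Fin N → ι, ∀ i j, i ≠ j → far (x (e i)) (x (e j))

variable {V : Type} [Fintype V] [Nonempty V]

theorem HasClique.of_comp {V ι κ : Type} {far : V → V → Prop} {N : ℕ} {x : ι → V} {σ : κ → ι}
    (h : HasClique far N (x ∘ σ)) : HasClique far N x := by
  obtain ⟨e, he⟩ := h
  exact ⟨σ ∘ e, he⟩

theorem card_isolated_le {V : Type} {far : V → V → Prop} {N q : ℕ} {x : Fin q → V}
    (h : ¬ HasClique far (N + 1) x) (I : Finset (Fin q))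
    (hI : ∀ j ∈ I, ∀ i, i ≠ j → far (x j) (x i)) : I.card ≤ N := by
  by_contra! hc
  obtain ⟨J, hJ, hJc⟩ := exists_subset_card_eq (Nat.succ_le_of_lt hc)
  refine h ⟨J.orderEmbOfFin hJc, fun i j hij => hI _ (hJ (J.orderEmbOfFin_mem hJc i)) _ ?_⟩
  simpa using hij.symm

theorem hasClique_of_cons {V : Type} {far : V → V → Prop} (hirr : ∀ v, ¬ far v v) {N q : ℕ}
    {v : V} {x : Fin q → V} (h : HasClique far (N + 1) (Fin.cons v x : Fin (q + 1) → V)) :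
    HasClique far N x := by
  obtain ⟨e, he⟩ := h
  -- By irreflexivity at most one member of the clique sits at index 0; that one is dropped, or an
  -- arbitrary one if there is none.
  obtain ⟨r, hr⟩ : ∃ r : Fin (N + 1), ∀ i, i ≠ r → e i ≠ 0 := by
    by_cases h0 : ∃ r, e r = 0
    · obtain ⟨r, hr⟩ := h0
      refine ⟨r, fun i hi h => ?_⟩
      have := he i r hi
      rw [h, hr] at this
      exact hirr _ this
    · push Not at h0
      exact ⟨0, fun i _ => h0 i⟩
  have hne : ∀ i, e (r.succAbove i) ≠ 0 := fun i => hr _ (Fin.succAbove_ne r i)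
  refine ⟨fun i => (e (r.succAbove i)).pred (hne i), fun i j hij => ?_⟩
  have h := he (r.succAbove i) (r.succAbove j) (by simpa using hij)
  rw [← Fin.succ_pred _ (hne i), ← Fin.succ_pred _ (hne j), Fin.cons_succ, Fin.cons_succ] at h
  exact h

/-- Leave-one-out: view `v` and the sample as q + 1 exchangeable points. The points far from all
others form a clique, so without an (N + 1)-clique at most N of them are isolated, and by symmetry
the point `v` is isolated with probability at most N/(q + 1). -/
theorem unifProb_far_le (far : V → V → Prop) (hirr : ∀ v, ¬ far v v) (N q : ℕ) :
    unifProb (fun ω : V × (Fin q → V) => (∀ i, far ω.1 (ω.2 i)) ∧ ¬ HasClique far N ω.2) ≤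
      N / (q + 1 : ℝ) := by
  classical
  let E : Fin (q + 1) → (Fin (q + 1) → V) → Prop := fun j x =>
    (∀ i, i ≠ j → far (x j) (x i)) ∧ ¬ HasClique far (N + 1) x
  have h1 : unifProb (fun ω : V × (Fin q → V) => (∀ i, far ω.1 (ω.2 i)) ∧
      ¬ HasClique far N ω.2) ≤ unifProb (E 0) := by
    rw [← unifProb_equiv (Fin.consEquiv fun _ => V) (E 0)]
    refine unifProb_mono fun ω hω => ⟨fun i hi => ?_, fun hc => hω.2 (hasClique_of_cons hirr hc)⟩
    obtain ⟨j, rfl⟩ := Fin.exists_succ_eq.2 hi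
    simpa [Fin.consEquiv] using hω.1 j
  have h2 : ∀ j, unifProb (E j) = unifProb (E 0) := by
    intro j
    rw [← unifProb_equiv ((Equiv.swap 0 j).arrowCongr (Equiv.refl V)) (E j)]
    have hsw : ∀ x : Fin (q + 1) → V, (Equiv.swap 0 j).arrowCongr (Equiv.refl V) x =
        x ∘ Equiv.swap 0 j := fun x => by ext; simp [Equiv.arrowCongr]
    refine le_antisymm (unifProb_mono fun x hx => ?_) (unifProb_mono fun x hx => ?_)
    · rw [hsw] at hx
      refine ⟨fun i hi => ?_, fun hc => hx.2 ?_⟩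
      · have := hx.1 (Equiv.swap 0 j i) (by
          intro h
          apply hi
          have := congrArg (Equiv.swap 0 j) h
          simpa using this)
        simpa using this
      · refine HasClique.of_comp (σ := Equiv.swap 0 j) ?_
        convert hc
        ext; simp
    · rw [hsw]
      refine ⟨fun i hi => ?_, fun hc => hx.2 hc.of_comp⟩
      have := hx.1 (Equiv.swap 0 j i) (by
        intro h
        apply hi
        have := congrArg (Equiv.swap 0 j) h
        simpa using this)
      simpa using this
  have h3 : ∑ j, unifProb (E j) ≤ N := by
    simp only [unifProb_eq]
    rw [← sum_div]
    refine div_le_of_le_mul₀ (by positivity) (by positivity) ?_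
    simp only [card_filter]
    push_cast
    rw [sum_comm]
    calc _ ≤ ∑ _x : Fin (q + 1) → V, (N : ℝ) := by
          refine sum_le_sum fun x _ => ?_
          by_cases hx : HasClique far (N + 1) x
          · simp [E, hx]
          · have := card_isolated_le hx (univ.filter fun j => E j x)
              fun j hj => (by simpa using hj : E j x).1
            rw [card_filter] at this
            exact_mod_cast this
      _ = _ := by simp [mul_comm]
  simp only [h2] at h3
  rw [sum_const, card_univ, Fintype.card_fin, nsmul_eq_mul] at h3
  push_cast at h3
  refine h1.trans ?_
  rw [le_div_iff₀ (by positivity)]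
  linarith

/-- Markov's inequality applied to `unifProb_far_le`, averaging over the sample first. -/
theorem unifProb_uncovered_le (far : V → V → Prop) (hirr : ∀ v, ¬ far v v) (N q : ℕ) {β : ℝ}
    (hβ : 0 < β) :
    unifProb (fun x : Fin q → V => ¬ HasClique far N x ∧
      β ≤ unifProb fun v => ∀ i, far v (x i)) ≤ N / ((q + 1 : ℝ) * β) := by
  classical
  have h := unifProb_far_le far hirr N q
  rw [unifProb_prod_swap (fun v x => (∀ i, far v (x i)) ∧ ¬ HasClique far N x),
    unifProb_prod (fun (x : Fin q → V) v => (∀ i, far v (x i)) ∧ ¬ HasClique far N x)] at h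
  have h2 : β * unifProb (fun x : Fin q → V => ¬ HasClique far N x ∧
      β ≤ unifProb fun v => ∀ i, far v (x i)) ≤ (∑ x : Fin q → V,
        unifProb fun v => (∀ i, far v (x i)) ∧ ¬ HasClique far N x) /
        (Fintype.card (Fin q → V) : ℝ) := by
    rw [unifProb_eq, ← mul_div_assoc, card_filter]
    push_cast
    rw [mul_sum]
    gcongr with x
    split_ifs with hx
    · simpa [hx.1] using hx.2
    · simpa using unifProb_nonneg _
  rw [← div_div, le_div_iff₀ hβ]
  linarith

end LeaveOneOut

end FinMatrix

namespace FinMatrix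

/-! ### Sauer–Shelah bound -/

section Shattering

open Finset

theorem sum_choose_range_le_pow (p d : ℕ) : ∑ i ∈ range d, p.choose i ≤ (p + 1) ^ d := by
  induction d with
  | zero => simp
  | succ d ih =>
    have h1 := Nat.choose_le_pow p d
    have h2 : p ^ d ≤ (p + 1) ^ d := Nat.pow_le_pow_left (Nat.le_succ p) d
    rcases Nat.eq_zero_or_pos p with rfl | hp
    · simp [sum_range_succ']
    · rw [sum_range_succ, pow_succ]
      have : (p + 1) ^ d ≤ (p + 1) ^ d * p := Nat.le_mul_of_pos_right _ hp
      linarith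

/-- More than `(p + 1) ^ d` binary vectors of length `p` realise all patterns on some `d`
coordinates. -/
theorem exists_all_patterns {ι : Type} [Fintype ι] {p d : ℕ} (u : ι → Fin p → Fin 2)
    (hu : Function.Injective u) (h : (p + 1) ^ d < Fintype.card ι) :
    ∃ c : Fin d → Fin p, ∀ φ : Fin d → Fin 2, ∃ i, ∀ j, u i (c j) = φ j := by
  classical
  let S : ι → Finset (Fin p) := fun i => univ.filter fun j => u i j = 1
  have h01 : ∀ a b : Fin 2, (a = 1 ↔ b = 1) → a = b := by decide
  have hS : Function.Injective S := fun i i' hii => hu <| funext fun j => h01 _ _ <| by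
    have := congrArg (fun T => j ∈ T) hii
    simpa [S] using this
  let 𝒜 : Finset (Finset (Fin p)) := univ.image S
  have hA : 𝒜.card = Fintype.card ι := by rw [card_image_of_injective _ hS, card_univ]
  -- With smaller VC dimension, Sauer–Shelah would bound the family by the sum of binomials below d,
  -- hence by (p + 1)^d.
  have hd : d ≤ 𝒜.vcDim := by
    by_contra! hlt
    have h1 := (card_le_card_shatterer 𝒜).trans card_shatterer_le_sum_vcDim
    rw [Fintype.card_fin] at h1
    have h2 : ∑ k ∈ Iic 𝒜.vcDim, p.choose k ≤ ∑ i ∈ range d, p.choose i :=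
      sum_le_sum_of_subset fun x hx => by
        rw [mem_Iic] at hx
        exact mem_range.2 (hx.trans_lt hlt)
    have := sum_choose_range_le_pow p d
    omega
  have hne : 𝒜.shatterer.Nonempty := by
    rw [← card_pos]
    refine lt_of_lt_of_le ?_ (card_le_card_shatterer 𝒜)
    omega
  obtain ⟨T, hT, hTc⟩ := exists_mem_eq_sup _ hne card
  have hTd : d ≤ T.card := by rw [← hTc]; exact hd
  obtain ⟨T', hT', hTd'⟩ := exists_subset_card_eq hTd
  have hsh := (mem_shatterer.1 hT).mono_right hT'
  let e := T'.orderEmbOfFin hTd'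
  refine ⟨e, fun φ => ?_⟩
  obtain ⟨U, hU, hUT⟩ := hsh (t := (univ.filter fun j => φ j = 1).image e) (by
    intro x hx
    obtain ⟨j, -, rfl⟩ := mem_image.1 hx
    exact T'.orderEmbOfFin_mem hTd' j)
  obtain ⟨i, -, rfl⟩ := mem_image.1 hU
  refine ⟨i, fun j => h01 _ _ ?_⟩
  have := congrArg (fun W => e j ∈ W) hUT
  simpa [S, e, T'.orderEmbOfFin_mem hTd' j] using this

end Shattering

/-! ### Copies up to row order, and patterns that force them -/

section Copies

open Finset

/-- Some member of `F` occurs in `M`, up to the order of its rows, with rows in `X` and columns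
in `Y`. -/
def HasCopy (F : Set (FinMatrix (Fin 2))) {m n : ℕ} (M : Matrix (Fin m) (Fin n) (Fin 2))
    (X : Finset (Fin m)) (Y : Finset (Fin n)) : Prop :=
  ∃ (s t : ℕ) (A : Matrix (Fin s) (Fin t) (Fin 2)), (⟨s, t, A⟩ : FinMatrix (Fin 2)) ∈ F ∧
    ∃ (f : Fin s → Fin m) (g : Fin t → Fin n), Function.Injective f ∧ StrictMono g ∧
      (∀ a, f a ∈ X) ∧ (∀ b, g b ∈ Y) ∧ ∀ a b, M (f a) (g b) = A a b

variable {F : Set (FinMatrix (Fin 2))} {m n : ℕ} {M : Matrix (Fin m) (Fin n) (Fin 2)}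

theorem HasCopy.mono {X X' : Finset (Fin m)} {Y Y' : Finset (Fin n)} (h : HasCopy F M X Y)
    (hX : X ⊆ X') (hY : Y ⊆ Y') : HasCopy F M X' Y' := by
  obtain ⟨s, t, A, hA, f, g, hf, hg, hfX, hgY, hM⟩ := h
  exact ⟨s, t, A, hA, f, g, hf, hg, fun a => hX (hfX a), fun b => hY (hgY b), hM⟩

theorem HasCopy.congr {M' : Matrix (Fin m) (Fin n) (Fin 2)} {X : Finset (Fin m)}
    {Y : Finset (Fin n)} (h : ∀ i ∈ X, ∀ j ∈ Y, M i j = M' i j) (hc : HasCopy F M X Y) :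
    HasCopy F M' X Y := by
  obtain ⟨s, t, A, hA, f, g, hf, hg, hfX, hgY, hM⟩ := hc
  exact ⟨s, t, A, hA, f, g, hf, hg, hfX, hgY, fun a b => by rw [← h _ (hfX a) _ (hgY b), hM]⟩

theorem mem_freeness_of_not_hasCopy (h : ¬ HasCopy F M univ univ) :
    (⟨m, n, M⟩ : FinMatrix (Fin 2)) ∈ freeness F := by
  rintro ⟨s, t, A⟩ hA ⟨f, g, hfg⟩
  exact h ⟨s, t, A, hA, f, g, f.injective, g.strictMono, by simp, by simp,
    fun a b => congrFun (congrFun hfg a) b⟩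

theorem not_hasCopy_of_mem_freeness (hrow : ClosedUnderRowPermutations F)
    (h : (⟨m, n, M⟩ : FinMatrix (Fin 2)) ∈ freeness F) (X : Finset (Fin m)) (Y : Finset (Fin n)) :
    ¬ HasCopy F M X Y := by
  rintro ⟨s, t, A, hA, f, g, hf, hg, -, -, hM⟩
  -- Sorting the rows of the copy turns it into a genuine submatrix, equal to a row permutation of
  -- `A`.
  have hsort : StrictMono (f ∘ Tuple.sort f) :=
    (Tuple.monotone_sort f).strictMono_of_injective (hf.comp (Tuple.sort f).injective)
  refine h _ (hrow s t A hA (Tuple.sort f)) ⟨OrderEmbedding.ofStrictMono _ hsort,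
    OrderEmbedding.ofStrictMono g hg, ?_⟩
  ext a b
  simp [hM]

/-- All members of `F` have at most `k` rows and at most `k` columns. -/
def SizesLE (F : Set (FinMatrix (Fin 2))) (k : ℕ) : Prop := ∀ A ∈ F, A.1 ≤ k ∧ A.2.1 ≤ k

/-- The first t of the 2k columns carry `A`. The last k serve as markers that force the chosen rows
to be distinct even where `A` has equal rows. -/
theorem hasCopy_of_all_patterns {k : ℕ} (hk : SizesLE F k) (hF : F.Nonempty)
    {X : Finset (Fin m)} {Y : Finset (Fin n)} (c : Fin (2 * k) → Fin n) (hc : ∀ j, c j ∈ Y)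
    (h : ∀ φ : Fin (2 * k) → Fin 2, ∃ x ∈ X, ∀ j, M x (c j) = φ j) : HasCopy F M X Y := by
  obtain ⟨⟨s, t, A⟩, hA⟩ := hF
  obtain ⟨hs, ht⟩ := hk _ hA
  simp only at hs ht
  have hcinj : Function.Injective c := fun j j' hj => by
    by_contra hne
    obtain ⟨x, -, hx⟩ := h fun l => if l = j then 1 else 0
    have h1 := hx j
    have h2 := hx j'
    rw [hj, h2] at h1
    simp [Ne.symm hne] at h1
  have hsort : StrictMono (c ∘ Tuple.sort c) :=
    (Tuple.monotone_sort c).strictMono_of_injective (hcinj.comp (Tuple.sort c).injective)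
  have h' : ∀ φ : Fin (2 * k) → Fin 2, ∃ x ∈ X, ∀ j, M x (c (Tuple.sort c j)) = φ j := by
    intro φ
    obtain ⟨x, hx, hM⟩ := h (φ ∘ (Tuple.sort c).symm)
    exact ⟨x, hx, fun j => by simp [hM]⟩
  -- As s, t ≤ k, the marker k + a of row a lies within the 2k columns and beyond the first t.
  let φ : Fin s → Fin (2 * k) → Fin 2 := fun a j =>
    if hj : j.1 < t then A a ⟨j.1, hj⟩ else if j.1 = k + a.1 then 1 else 0
  choose f hfX hf using fun a => h' (φ a)
  refine ⟨s, t, A, hA, f, fun b => c (Tuple.sort c ⟨b.1, by omega⟩), fun a a' haa => ?_,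
    fun b b' hb => hsort (by simpa using hb), hfX, fun b => hc _, fun a b => ?_⟩
  · have h1 := hf a ⟨k + a.1, by omega⟩
    have h2 := hf a' ⟨k + a.1, by omega⟩
    rw [haa, h2] at h1
    have h3 : ¬ k + a.1 < t := by omega
    simp only [φ, h3, dif_neg, not_false_eq_true, if_true] at h1
    exact Fin.ext (by simpa using h1)
  · rw [hf]
    simp [φ]

/-- Many pairwise distinct rows on few columns contain a copy. -/
theorem hasCopy_of_rows {k p N : ℕ} (hk : SizesLE F k) (hF : F.Nonempty)
    {X : Finset (Fin m)} {Y : Finset (Fin n)} (x : Fin N → Fin m) (hx : ∀ i, x i ∈ X)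
    (y : Fin p → Fin n) (hy : ∀ j, y j ∈ Y) (hN : (p + 1) ^ (2 * k) < N)
    (h : ∀ i i', i ≠ i' → ∃ j, M (x i) (y j) ≠ M (x i') (y j)) : HasCopy F M X Y := by
  obtain ⟨c, hc⟩ := exists_all_patterns (d := 2 * k) (fun i j => M (x i) (y j)) (fun i i' hii => by
    by_contra hne
    obtain ⟨j, hj⟩ := h i i' hne
    exact hj (congrFun hii j)) (by simpa using hN)
  refine hasCopy_of_all_patterns hk hF (fun j => y (c j)) (fun j => hy _) fun φ => ?_
  obtain ⟨i, hi⟩ := hc φ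
  exact ⟨x i, hx i, hi⟩

/-- Many pairwise distinct columns on few rows contain a copy. -/
theorem hasCopy_of_columns {k r N : ℕ} (hk : SizesLE F k) (hF : F.Nonempty)
    {X : Finset (Fin m)} {Y : Finset (Fin n)} (x : Fin r → Fin m) (hx : ∀ i, x i ∈ X)
    (y : Fin N → Fin n) (hy : ∀ j, y j ∈ Y) (hN : (r + 1) ^ (2 ^ (2 * k)) < N)
    (h : ∀ j j', j ≠ j' → ∃ i, M (x i) (y j) ≠ M (x i) (y j')) : HasCopy F M X Y := by
  obtain ⟨c, hc⟩ := exists_all_patterns (d := 2 ^ (2 * k)) (fun j i => M (x i) (y j))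
    (fun j j' hjj => by
      by_contra hne
      obtain ⟨i, hi⟩ := h j j' hne
      exact hi (congrFun hjj i)) (by simpa using hN)
  -- Dual shattering: the 2^(2k) shattered rows are indexed by the patterns φ, and column `e j` has
  -- the value φ j in row φ, so these rows realise all patterns on the columns `e`.
  choose e he using fun j : Fin (2 * k) => hc fun l => finFunctionFinEquiv.symm l j
  refine hasCopy_of_all_patterns hk hF (fun j => y (e j)) (fun j => hy _) fun φ =>
    ⟨x (c (finFunctionFinEquiv φ)), hx _, fun j => ?_⟩
  simpa using he j (finFunctionFinEquiv φ)

end Copies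

end FinMatrix

namespace FinMatrix

/-! ### From samples to query algorithms -/

section Tester

open Finset

variable {m n : ℕ}

theorem exists_queryAlg (S : Finset (Fin m × Fin n)) :
    ∀ dec : Matrix (Fin m) (Fin n) (Fin 2) → Bool,
      (∀ M M', (∀ p ∈ S, M p.1 p.2 = M' p.1 p.2) → dec M = dec M') →
      ∃ t : QueryAlg (Fin 2) m n, ∀ M, t.output M = dec M ∧ t.queries M = S.card := by
  classical
  induction S using Finset.induction_on with
  | empty =>
    intro dec hdec
    exact ⟨.halt (dec 0), fun M => ⟨hdec _ _ (by simp), rfl⟩⟩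
  | insert p S hp ih =>
    intro dec hdec
    -- Overwriting the entry `p` by the value just read leaves a decision that depends on `S` alone.
    let upd : Fin 2 → Matrix (Fin m) (Fin n) (Fin 2) → Matrix (Fin m) (Fin n) (Fin 2) :=
      fun γ M i j => if (i, j) = p then γ else M i j
    have h : ∀ γ, ∃ t : QueryAlg (Fin 2) m n, ∀ M,
        t.output M = dec (upd γ M) ∧ t.queries M = S.card := fun γ =>
      ih _ fun M M' hM => hdec _ _ fun q hq => by
        by_cases hqp : q = p
        · simp [upd, hqp]
        · simpa [upd, hqp] using hM q ((mem_insert.1 hq).resolve_left hqp)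
    choose t ht using h
    refine ⟨.query p.1 p.2 t, fun M => ⟨?_, ?_⟩⟩
    · rw [QueryAlg.output, (ht _ M).1]
      refine hdec _ _ fun q hq => ?_
      by_cases hqp : q = p
      · simp [upd, hqp]
      · simp [upd, hqp]
    · rw [QueryAlg.queries, (ht _ M).2, card_insert_of_notMem hp]

theorem map_uniformOfFintype_apply {Ω β : Type} [Fintype Ω] [Nonempty Ω] (f : Ω → β) (b : β) :
    ((PMF.uniformOfFintype Ω).map f) b = ENNReal.ofReal (unifProb fun ω => f ω = b) := by
  classical
  have hpos : (0 : ℝ) < Fintype.card Ω := by exact_mod_cast Fintype.card_pos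
  rw [PMF.map_apply, tsum_fintype, unifProb_eq, ENNReal.ofReal_div_of_pos hpos,
    ENNReal.ofReal_natCast, ENNReal.ofReal_natCast, div_eq_mul_inv, card_filter, Nat.cast_sum,
    sum_mul]
  refine sum_congr rfl fun ω _ => ?_
  by_cases h : f ω = b
  · simp [h]
  · simp [h, Ne.symm h]

variable {F : Set (FinMatrix (Fin 2))}

/-- If the restrictions of far matrices to random sets of rows and columns usually contain a copy
of a member of `F`, then querying these restrictions is a one-sided test. -/
theorem exists_test {q : ℕ} {ε : ℝ} (hrow : ClosedUnderRowPermutations F) {Ω : Type} [Fintype Ω]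
    [Nonempty Ω] (X : Ω → Finset (Fin m)) (Y : Ω → Finset (Fin n))
    (hq : ∀ ω, (X ω).card * (Y ω).card ≤ q)
    (hfar : ∀ M : Matrix (Fin m) (Fin n) (Fin 2), IsFar (freeness F) ε M →
      unifProb (fun ω => ¬ HasCopy F M (X ω) (Y ω)) ≤ 1 / 3) :
    ∃ T : PMF (QueryAlg (Fin 2) m n), (∀ M : Matrix (Fin m) (Fin n) (Fin 2),
      ((⟨m, n, M⟩ : FinMatrix (Fin 2)) ∈ freeness F →
        (T.map fun t => t.output M) true = 1 ∧ (T.map fun t => t.output M) false ≤ 1 / 3) ∧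
      (IsFar (freeness F) ε M → (T.map fun t => t.output M) true ≤ 1 / 3)) ∧
      ∀ M, ∀ t ∈ T.support, t.queries M ≤ q := by
  classical
  have h : ∀ ω, ∃ t : QueryAlg (Fin 2) m n, ∀ M,
      t.output M = decide (¬ HasCopy F M (X ω) (Y ω)) ∧
      t.queries M = (X ω ×ˢ Y ω).card := fun ω =>
    exists_queryAlg _ _ fun M M' hM => by
      have hM' : ∀ i ∈ X ω, ∀ j ∈ Y ω, M i j = M' i j := fun i hi j hj =>
        hM (i, j) (mem_product.2 ⟨hi, hj⟩)
      have : HasCopy F M (X ω) (Y ω) ↔ HasCopy F M' (X ω) (Y ω) :=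
        ⟨.congr hM', .congr fun i hi j hj => (hM' i hi j hj).symm⟩
      simp [this]
  choose t ht using h
  have hprob : ∀ (M : Matrix (Fin m) (Fin n) (Fin 2)) (b : Bool),
      (((PMF.uniformOfFintype Ω).map t).map fun t => t.output M) b =
        ENNReal.ofReal (unifProb fun ω => decide (¬ HasCopy F M (X ω) (Y ω)) = b) := by
    intro M b
    rw [PMF.map_comp, map_uniformOfFintype_apply]
    simp [(ht _ M).1]
  refine ⟨(PMF.uniformOfFintype Ω).map t, fun M => ⟨fun hM => ?_, fun hM => ?_⟩, fun M s hs => ?_⟩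
  · have hno : ∀ ω, ¬ HasCopy F M (X ω) (Y ω) := fun ω =>
      not_hasCopy_of_mem_freeness hrow hM _ _
    rw [hprob, hprob]
    simp [hno, unifProb_eq]
  · rw [hprob]
    simp only [decide_eq_true_eq]
    calc _ ≤ ENNReal.ofReal (1 / 3) := ENNReal.ofReal_le_ofReal (hfar M hM)
      _ = 1 / 3 := by
        rw [ENNReal.ofReal_div_of_pos (by norm_num)]
        simp
  · rw [PMF.mem_support_map_iff] at hs
    obtain ⟨ω, -, rfl⟩ := hs
    rw [(ht ω M).2, card_product]
    exact hq ω

end Tester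

/-! ### Ordered occurrences of words of columns -/

section Staircase

open Finset

variable {n : ℕ}

/-- The count grows by at most one per column, so just before it first exceeds h it equals h; if it
never exceeds h, a threshold past the last column works. -/
theorem exists_threshold (A : Finset (Fin n)) (x h : ℕ) : ∃ x', x ≤ x' ∧
    (A.filter fun c => x ≤ c.1 ∧ c.1 < x').card ≤ h ∧
    ((A.filter fun c => x ≤ c.1 ∧ c.1 < x').card = h ∨ n ≤ x') := by
  classical
  by_cases hbig : ∃ x', h < (A.filter fun c => x ≤ c.1 ∧ c.1 < x').card
  · have h1 := Nat.find_spec hbig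
    have h2 := fun y => Nat.find_min hbig (m := y)
    generalize Nat.find hbig = z at h1 h2
    obtain ⟨c, hc⟩ := card_pos.1 (Nat.zero_lt_of_lt h1)
    simp only [mem_filter] at hc
    obtain ⟨y, rfl⟩ : ∃ y, z = y + 1 := ⟨z - 1, by omega⟩
    have h3 := h2 y (Nat.lt_succ_self y)
    have h4 : (A.filter fun c => x ≤ c.1 ∧ c.1 < y + 1).card ≤
        (A.filter fun c => x ≤ c.1 ∧ c.1 < y).card + 1 := by
      by_cases hy : y < n
      · refine (card_le_card (t := insert ⟨y, hy⟩ (A.filter fun c => x ≤ c.1 ∧ c.1 < y))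
          fun d hd => ?_).trans (card_insert_le _ _)
        simp only [mem_filter, mem_insert, Fin.ext_iff] at hd ⊢
        by_cases hdy : d.1 = y
        · exact Or.inl hdy
        · exact Or.inr ⟨hd.1, hd.2.1, by omega⟩
      · refine (card_le_card fun d hd => ?_).trans (Nat.le_succ _)
        simp only [mem_filter] at hd ⊢
        exact ⟨hd.1, hd.2.1, by omega⟩
    exact ⟨y, by omega, by omega, Or.inl (by omega)⟩
  · push Not at hbig
    exact ⟨x + n, by omega, hbig _, Or.inr (by omega)⟩

/-- Deleting a few columns `S b` for each `b` destroys all monotone occurrences of `L`, unless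
the sets `S b` are large and in increasing order. -/
theorem exists_staircase (L : ℕ → Finset (Fin n)) (h : ℕ) : ∃ S : ℕ → Finset (Fin n),
    (∀ b, S b ⊆ L b) ∧ (∀ b, (S b).card ≤ h) ∧
    (∀ b b', b < b' → ∀ c ∈ S b, ∀ c' ∈ S b', c < c') ∧
    ∀ (t : ℕ) (p : Fin t → Fin n), Monotone p → (∀ b : Fin t, p b ∈ L b ∧ p b ∉ S b) →
      ∀ b : Fin t, (S b).card = h := by
  classical
  -- Greedy choice: `S b` consists of the first h members of `L b` from the current threshold on, or
  -- of all of them if there are fewer.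
  choose nx hnx1 hnx2 hnx3 using fun (b x : ℕ) => exists_threshold (L b) x h
  obtain ⟨thr, hzero, hsucc⟩ : ∃ thr : ℕ → ℕ, thr 0 = 0 ∧ ∀ b, thr (b + 1) = nx b (thr b) :=
    ⟨fun b => Nat.rec (motive := fun _ => ℕ) 0 (fun b x => nx b x) b, rfl, fun _ => rfl⟩
  have hmono : Monotone thr := monotone_nat_of_le_succ fun b => by
    rw [hsucc]
    exact hnx1 _ _
  let S : ℕ → Finset (Fin n) := fun b => (L b).filter fun c : Fin n => thr b ≤ c.1 ∧ c.1 < thr (b + 1)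
  have hmem : ∀ {b} {c : Fin n}, c ∈ S b ↔ c ∈ L b ∧ thr b ≤ c.1 ∧ c.1 < thr (b + 1) := by simp [S]
  have hcard : ∀ b, (S b).card ≤ h := fun b => by
    have := hnx2 b (thr b)
    rwa [← hsucc] at this
  refine ⟨S, fun b c hc => (hmem.1 hc).1, hcard, fun b b' hb c hc c' hc' => ?_,
    fun t p hp hpL => ?_⟩
  · have := (hmem.1 hc).2.2
    have := (hmem.1 hc').2.1
    have : thr (b + 1) ≤ thr b' := hmono hb
    exact Fin.lt_def.2 (by omega)
  -- An occurrence that avoids the sets `S b` is pushed past every threshold in turn. Its letters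
  -- are columns below n, so no threshold that it passes reached n and each `S b` is full.
  · have step : ∀ b : Fin t, thr b ≤ (p b).1 → thr (b + 1) ≤ (p b).1 := fun b hb => by
      by_contra! hlt
      exact (hpL b).2 (hmem.2 ⟨(hpL b).1, hb, hlt⟩)
    have key : ∀ b (hb : b < t), thr b ≤ (p ⟨b, hb⟩).1 := by
      intro b
      induction b with
      | zero => intro _; rw [hzero]; exact Nat.zero_le _
      | succ b ih =>
        intro hb
        refine (step ⟨b, by omega⟩ (ih _)).trans (Fin.le_def.1 (hp ?_))
        simp
    intro b
    have h1 := step b (key b b.2)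
    have h2 := hnx3 b (thr b)
    rw [← hsucc] at h2
    refine h2.resolve_right fun hn => ?_
    have := (p b).2
    omega

/-- Send a column to the last element of `K` not after it, or to the first element of `K` if there
is none. -/
theorem exists_monotone_retraction (K : Finset (Fin n)) (hK : K.Nonempty) :
    ∃ π : Fin n → Fin n, Monotone π ∧ (∀ c, π c ∈ K) ∧ ∀ c ∈ K, π c = c := by
  classical
  let π : Fin n → Fin n := fun c =>
    if h : (K.filter fun d => d ≤ c).Nonempty then (K.filter fun d => d ≤ c).max' h else K.min' hK
  have hmem : ∀ c, π c ∈ K := fun c => by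
    by_cases h : (K.filter fun d => d ≤ c).Nonempty
    · simp only [π, h, dif_pos]
      exact (mem_filter.1 (max'_mem _ h)).1
    · simp only [π, h, dif_neg, not_false_eq_true]
      exact min'_mem _ _
  refine ⟨π, fun c c' hc => ?_, hmem, fun c hc => ?_⟩
  · by_cases h : (K.filter fun d => d ≤ c).Nonempty
    · have hsub : (K.filter fun d => d ≤ c) ⊆ K.filter fun d => d ≤ c' := fun d hd => by
        simp only [mem_filter] at hd ⊢
        exact ⟨hd.1, hd.2.trans hc⟩
      have h' := h.mono hsub
      simp only [π, h, h', dif_pos]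
      exact max'_subset h hsub
    · calc π c = K.min' hK := by simp only [π, h, dif_neg, not_false_eq_true]
        _ ≤ π c' := min'_le _ _ (hmem c')
  · have h : (K.filter fun d => d ≤ c).Nonempty := ⟨c, by simp [hc]⟩
    simp only [π, h, dif_pos]
    refine le_antisymm (max'_le _ _ _ fun d hd => (mem_filter.1 hd).2) (le_max' _ _ (by simp [hc]))

end Staircase

end FinMatrix

namespace FinMatrix

/-! ### Random columns relative to fixed rows -/

section Columns

open Finset

variable {F : Set (FinMatrix (Fin 2))} {m n r : ℕ}

open Classical in
/-- The columns of `M` can be changed, few of them as far as the rows `x` are concerned, such that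
afterwards every choice of at most `k` columns can be realised in `Y \ D`, on the rows `x`. -/
def ColumnsGood (k e : ℕ) (M : Matrix (Fin m) (Fin n) (Fin 2)) (x : Fin r → Fin m)
    (D Y : Finset (Fin n)) : Prop :=
  ∃ π : Fin n → Fin n,
    4 * e * (univ.filter fun c => ∃ i, M (x i) c ≠ M (x i) (π c)).card ≤ n ∧
    ∀ t ≤ k, ∀ g : Fin t → Fin n, StrictMono g → ∃ g' : Fin t → Fin n, StrictMono g' ∧
      (∀ b, g' b ∈ Y ∧ g' b ∉ D) ∧ ∀ b i, M (x i) (g' b) = M (x i) (π (g b))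

theorem ColumnsGood.mono {k e : ℕ} {M : Matrix (Fin m) (Fin n) (Fin 2)} {x : Fin r → Fin m}
    {D Y Y' : Finset (Fin n)} (h : ColumnsGood k e M x D Y) (hY : Y ⊆ Y') :
    ColumnsGood k e M x D Y' := by
  obtain ⟨π, h1, h2⟩ := h
  refine ⟨π, h1, fun t ht g hg => ?_⟩
  obtain ⟨g', h3, h4, h5⟩ := h2 t ht g hg
  exact ⟨g', h3, fun b => ⟨hY (h4 b).1, (h4 b).2⟩, h5⟩

theorem columnsGood_univ (k e : ℕ) (M : Matrix (Fin m) (Fin n) (Fin 2)) (x : Fin r → Fin m) :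
    ColumnsGood k e M x ∅ univ :=
  ⟨id, by simp, fun _ _ g hg => ⟨g, hg, by simp, by simp⟩⟩

/-- Two columns that differ on the rows `x`. -/
def ColumnsDiffer (M : Matrix (Fin m) (Fin n) (Fin 2)) (x : Fin r → Fin m) (c c' : Fin n) : Prop :=
  ∃ i, M (x i) c ≠ M (x i) c'

open Classical in
/-- The columns outside `D` that agree, on the rows `x`, with the column `y (w b)`. -/
noncomputable def wordColumns {k p : ℕ} (M : Matrix (Fin m) (Fin n) (Fin 2)) (x : Fin r → Fin m)
    (D : Finset (Fin n)) (y : Fin p → Fin n) (w : Fin k → Fin p) (b : ℕ) : Finset (Fin n) :=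
  if h : b < k then univ.filter fun c => c ∉ D ∧ ¬ ColumnsDiffer M x c (y (w ⟨b, h⟩)) else ∅

theorem mem_wordColumns {k p : ℕ} {M : Matrix (Fin m) (Fin n) (Fin 2)} {x : Fin r → Fin m}
    {D : Finset (Fin n)} {y : Fin p → Fin n} {w : Fin k → Fin p} {b : ℕ} (h : b < k) {c : Fin n} :
    c ∈ wordColumns M x D y w b ↔ c ∉ D ∧ ∀ i, M (x i) c = M (x i) (y (w ⟨b, h⟩)) := by
  simp [wordColumns, h, ColumnsDiffer]

-- The columns to discard are those of a type not sampled, those in `D`, and all staircase sets.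
-- After retracting onto the rest, any choice of columns spells a word in the sampled types that
-- avoids its staircase; the sets of that staircase are then full, and the columns of `Y` in them
-- spell the same word in increasing order.
open Classical in
theorem columnsGood_of_hits {k e p h : ℕ} {M : Matrix (Fin m) (Fin n) (Fin 2)} {x : Fin r → Fin m}
    {D Y : Finset (Fin n)} {y : Fin p → Fin n} (hn : 0 < n) (he : 0 < e) (hp : 0 < p)
    (hunc : 8 * e * (univ.filter fun c => ∀ i, ColumnsDiffer M x c (y i)).card ≤ n)
    (hD : 16 * e * D.card ≤ n) (hh : 16 * e * (p ^ k * k * h) ≤ n)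
    (S : (Fin k → Fin p) → ℕ → Finset (Fin n))
    (hScard : ∀ w b, (S w b).card ≤ h) (hSL : ∀ w b, S w b ⊆ wordColumns M x D y w b)
    (hSlt : ∀ w b b', b < b' → ∀ c ∈ S w b, ∀ c' ∈ S w b', c < c')
    (hS : ∀ w (t : ℕ) (p : Fin t → Fin n), Monotone p →
      (∀ b : Fin t, p b ∈ wordColumns M x D y w b ∧ p b ∉ S w b) → ∀ b : Fin t, (S w b).card = h)
    (hits : ∀ w (b : Fin k), (S w b).card = h → ∃ c ∈ Y, c ∈ S w b) :
    ColumnsGood k e M x D Y := by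
  let U := univ.filter fun c => ∀ i, ColumnsDiffer M x c (y i)
  let T : Finset (Fin n) := univ.biUnion fun wb : (Fin k → Fin p) × Fin k => S wb.1 wb.2
  have hT : T.card ≤ p ^ k * k * h := by
    refine (card_biUnion_le_card_mul _ _ h fun wb _ => hScard _ _).trans ?_
    simp
  let Del := U ∪ D ∪ T
  -- The shares are 1/(8e) for `U` and 1/(16e) each for `D` and `T`.
  have hDel : 4 * e * Del.card ≤ n := by
    have h1 : Del.card ≤ U.card + D.card + T.card :=
      (card_union_le _ _).trans (Nat.add_le_add_right (card_union_le _ _) _)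
    have h2 : 16 * e * T.card ≤ n := (Nat.mul_le_mul_left _ hT).trans hh
    have h3 : 8 * e * U.card ≤ n := hunc
    have h4 : 16 * e * Del.card ≤ 16 * e * (U.card + D.card + T.card) := Nat.mul_le_mul_left _ h1
    nlinarith
  have hK : (univ \ Del).Nonempty := by
    rw [← card_pos, ← compl_eq_univ_sdiff, card_compl, Fintype.card_fin]
    have : 4 * 1 * Del.card ≤ 4 * e * Del.card := by gcongr; omega
    omega
  obtain ⟨π, hπ, hπK, hπid⟩ := exists_monotone_retraction _ hK
  refine ⟨π, le_trans (Nat.mul_le_mul_left _ (card_le_card fun c hc => ?_)) hDel, ?_⟩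
  · by_contra hcD
    obtain ⟨i, hi⟩ := (mem_filter.1 hc).2
    exact hi (by rw [hπid c (mem_sdiff.2 ⟨mem_univ _, hcD⟩)])
  intro t ht g hg
  have hkeep : ∀ c, π c ∉ U ∧ π c ∉ D ∧ π c ∉ T := fun c => by
    have := (mem_sdiff.1 (hπK c)).2
    simpa only [Del, mem_union, not_or, and_assoc] using this
  have hidx : ∀ c, ∃ j, ∀ i, M (x i) (π c) = M (x i) (y j) := fun c => by
    by_contra! hno
    exact (hkeep c).1 (mem_filter.2 ⟨mem_univ _, hno⟩)
  choose idx hidx using hidx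
  -- Words have fixed length k; the letters from t on are padding that the occurrence never uses.
  let w : Fin k → Fin p := fun b => if h : b.1 < t then idx (g ⟨b.1, h⟩) else ⟨0, hp⟩
  -- π may merge columns, so the occurrence is only weakly monotone.
  have hocc := hS w t (fun b => π (g b)) (hπ.comp hg.monotone) fun b => by
    refine ⟨(mem_wordColumns (by omega)).2 ⟨(hkeep _).2.1, fun i => ?_⟩, fun hmem => ?_⟩
    · simp only [w, b.2, dif_pos, Fin.eta]
      exact hidx _ i
    · exact (hkeep (g b)).2.2 (mem_biUnion.2 ⟨(w, ⟨b.1, by omega⟩), mem_univ _, hmem⟩)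
  choose g' hg'Y hg'S using fun b : Fin t => hits w ⟨b.1, by omega⟩ (hocc b)
  refine ⟨g', fun b b' hb => hSlt w b b' hb _ (hg'S b) _ (hg'S b'), fun b => ⟨hg'Y b, ?_⟩, ?_⟩
  · exact ((mem_wordColumns (by omega)).1 (hSL w b (hg'S b))).1
  · intro b i
    have h1 := ((mem_wordColumns (by omega)).1 (hSL w b (hg'S b))).2 i
    rw [h1, hidx (g b) i]
    simp [w]

/-- Random columns `y.1` and `y.2` contain a copy of a member of `F`, or else are usually good. -/
theorem unifProb_not_columnsGood_le {k e p q a : ℕ} (hk : SizesLE F k) (hF : F.Nonempty)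
    (hk0 : 0 < k) (M : Matrix (Fin m) (Fin n) (Fin 2)) (x : Fin r → Fin m) (D : Finset (Fin n))
    (hn : 0 < n) (he : 0 < e) (hp : p = 800 * e * ((r + 1) ^ (2 ^ (2 * k)) + 1))
    (ha : a = 32 * e * k * p ^ k) (han : a ≤ n) (hq : q = 100 * k * p ^ k * a)
    (hD : 16 * e * D.card ≤ n) :
    unifProb (fun y : (Fin p → Fin n) × (Fin q → Fin n) =>
      ¬ HasCopy F M (univ.image x) (univ.image y.1) ∧
      ¬ ColumnsGood k e M x D (univ.image y.2)) ≤ 2 / 100 := by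
  classical
  have : Nonempty (Fin n) := ⟨⟨0, hn⟩⟩
  have hp0 : 0 < p := by rw [hp]; positivity
  have ha0 : 0 < a := by rw [ha]; positivity
  have hnR : (0 : ℝ) < n := by exact_mod_cast hn
  have heR : (0 : ℝ) < e := by exact_mod_cast he
  set N := (r + 1) ^ (2 ^ (2 * k)) + 1 with hN
  let h := n / a + 1
  -- Since a ≤ n, rounding n/a up still gives a * h ≤ 2n, while h > n/a makes full sets easy to hit.
  have hh : 16 * e * (p ^ k * k * h) ≤ n := by
    have h1 : a * (n / a) ≤ n := Nat.mul_div_le n a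
    have h2 : 2 * (16 * e * (p ^ k * k * h)) = a * (n / a) + a := by
      rw [show h = n / a + 1 from rfl]
      generalize n / a = d
      rw [ha]
      ring
    omega
  choose S hSL hScard hSlt hS using fun (y : Fin p → Fin n) (w : Fin k → Fin p) =>
    exists_staircase (wordColumns M x D y w) h
  let A : (Fin p → Fin n) → Prop := fun y => ¬ HasClique (ColumnsDiffer M x) N y ∧
    1 / (8 * e : ℝ) ≤ unifProb fun c => ∀ i, ColumnsDiffer M x c (y i)
  let B : (Fin p → Fin n) → (Fin q → Fin n) → Prop := fun y z =>
    ∃ wb : (Fin k → Fin p) × Fin k, (S y wb.1 wb.2).card = h ∧ ∀ j, z j ∉ S y wb.1 wb.2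
  have hA : unifProb A ≤ 1 / 100 := by
    refine (unifProb_uncovered_le _ (fun c hc => ?_) N p (by positivity)).trans ?_
    · obtain ⟨i, hi⟩ := hc
      exact hi rfl
    · rw [hp]
      push_cast
      rw [div_le_div_iff₀ (by positivity) (by norm_num), add_mul,
        show (800 * e * (N : ℝ)) * (1 / (8 * e)) = 100 * N by field_simp; ring]
      have : (0 : ℝ) ≤ 1 * (1 / (8 * e)) := by positivity
      linarith
  -- Union bound over the k * p^k pairs of a word and a position; a full set has density at least
  -- 1/a.
  have hB : ∀ y, unifProb (B y) ≤ 1 / 100 := by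
    intro y
    have hx : (0 : ℝ) < 100 * k * p ^ k := by positivity
    refine (unifProb_exists_le_mul (c := 1 / (100 * k * p ^ k)) _ fun wb => ?_).trans ?_
    · by_cases hc : (S y wb.1 wb.2).card = h
      · have haR : (0 : ℝ) < a := by exact_mod_cast ha0
        refine (unifProb_mono (q := fun z : Fin q → Fin n => ∀ j, z j ∉ S y wb.1 wb.2)
          fun z hz => hz.2).trans ?_
        refine (unifProb_miss_le q (S y wb.1 wb.2) (β := 1 / a) ?_).trans ?_
        · rw [hc, Fintype.card_fin, one_div, inv_mul_le_iff₀ haR]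
          have : n < a * (n / a + 1) := by
            rw [mul_add, mul_one]
            have := Nat.div_add_mod n a
            have := Nat.mod_lt n ha0
            omega
          exact_mod_cast this.le
        · have h1 : (1 / a : ℝ) * q = 100 * k * p ^ k := by
            rw [hq]
            push_cast
            field_simp
          rw [h1, Real.exp_neg, one_div]
          refine inv_anti₀ hx ?_
          linarith [Real.add_one_le_exp (100 * k * (p : ℝ) ^ k)]
      · simp only [hc, false_and]
        simp [unifProb_eq]
        positivity
    · simp only [Fintype.card_prod, Fintype.card_fun, Fintype.card_fin]
      push_cast
      apply le_of_eq
      field_simp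
  have hsub : ∀ y : (Fin p → Fin n) × (Fin q → Fin n),
      (¬ HasCopy F M (univ.image x) (univ.image y.1) ∧
        ¬ ColumnsGood k e M x D (univ.image y.2)) → A y.1 ∨ B y.1 y.2 := by
    rintro ⟨y, z⟩ ⟨h1, h2⟩
    by_contra hAB
    rw [not_or] at hAB
    obtain ⟨hA', hB'⟩ := hAB
    have hcl : ¬ HasClique (ColumnsDiffer M x) N y := by
      rintro ⟨d, hd⟩
      exact h1 (hasCopy_of_columns hk hF x (by simp) (fun j => y (d j)) (by simp)
        (Nat.lt_succ_self _) hd)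
    have hunc : (unifProb fun c => ∀ i, ColumnsDiffer M x c (y i)) < 1 / (8 * e : ℝ) := by
      by_contra! hlt
      exact hA' ⟨hcl, hlt⟩
    refine h2 (columnsGood_of_hits (h := h) (y := y) hn he hp0 ?_ hD hh (S y) (hScard y) (hSL y)
      (hSlt y) (hS y) fun w b hb => ?_)
    · rw [unifProb_eq, div_lt_div_iff₀ (by simpa using hnR) (by positivity), Fintype.card_fin,
        one_mul] at hunc
      have : (8 * e * (univ.filter fun c => ∀ i, ColumnsDiffer M x c (y i)).card : ℝ) ≤ n := by
        linarith
      exact_mod_cast this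
    · by_contra! hno
      exact hB' ⟨(w, b), hb, fun j hj => hno (z j) (by simp) hj⟩
  calc _ ≤ unifProb (fun y : (Fin p → Fin n) × (Fin q → Fin n) => A y.1 ∨ B y.1 y.2) :=
        unifProb_mono hsub
    _ ≤ _ := unifProb_or_le _ _
    _ ≤ 1 / 100 + 1 / 100 := by
        gcongr
        · have : Nonempty (Fin q → Fin n) := inferInstance
          rw [balanced_fst A]
          exact hA
        · exact unifProb_prod_le (by norm_num) hB
    _ = 2 / 100 := by norm_num

end Columns

end FinMatrix

namespace FinMatrix

/-! ### Representatives and substitutes for rows -/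

section Rows

open Finset

variable {F : Set (FinMatrix (Fin 2))} {m n r : ℕ}

/-- The set of columns in which two rows differ. -/
def rowDiff (M : Matrix (Fin m) (Fin n) (Fin 2)) (i i' : Fin m) : Finset (Fin n) :=
  univ.filter fun c => M i c ≠ M i' c

/-- Two rows that differ in at least a `1 / a` fraction of the columns. -/
def RowsFar (a : ℕ) (M : Matrix (Fin m) (Fin n) (Fin 2)) (i i' : Fin m) : Prop :=
  n ≤ a * (rowDiff M i i').card

theorem not_rowsFar_self (a : ℕ) (M : Matrix (Fin m) (Fin n) (Fin 2)) (hn : 0 < n) (i : Fin m) :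
    ¬ RowsFar a M i i := by
  simp [RowsFar, rowDiff, hn.ne']

/-- Replacing every row `i` of `M` by the row `x (ρ i)` changes few entries, and every row `x l`
has `k` different substitutes `z b l` in `X` that agree with it outside `D`. -/
def RowsGood (k e : ℕ) (M : Matrix (Fin m) (Fin n) (Fin 2)) (x : Fin r → Fin m)
    (X : Finset (Fin m)) (D : Finset (Fin n)) : Prop :=
  ∃ (ρ : Fin m → Fin r) (z : Fin k → Fin r → Fin m),
    (∀ b l, z b l ∈ X) ∧ (∀ b b' i i', b ≠ b' → i ≠ i' → z b (ρ i) ≠ z b' (ρ i')) ∧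
    (∀ b l, ∀ c ∉ D, M (z b l) c = M (x l) c) ∧
    2 * e * ∑ i, (rowDiff M i (x (ρ i))).card ≤ m * n

/-- Row a of a copy in N moves to the substitute from batch a of its representative, so rows with a
common representative stay distinct. The new columns avoid `D`, where alone a substitute may differ.
Replacing rows costs 1/(2e) of the entries and replacing columns 1/(4e). -/
theorem exists_close_of_good {k e : ℕ} (hk : SizesLE F k) {M : Matrix (Fin m) (Fin n) (Fin 2)}
    {x : Fin r → Fin m} {X : Finset (Fin m)} {D Y : Finset (Fin n)}
    (hR : RowsGood k e M x X D) (hC : ColumnsGood k e M x D Y) (hno : ¬ HasCopy F M X Y) :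
    ∃ N : Matrix (Fin m) (Fin n) (Fin 2), (⟨m, n, N⟩ : FinMatrix (Fin 2)) ∈ freeness F ∧
      4 * e * entryDist M N ≤ 3 * (m * n) := by
  classical
  obtain ⟨ρ, z, hzX, hz, hzD, hsum⟩ := hR
  obtain ⟨π, hπ, hg⟩ := hC
  let N : Matrix (Fin m) (Fin n) (Fin 2) := fun i c => M (x (ρ i)) (π c)
  refine ⟨N, mem_freeness_of_not_hasCopy ?_, ?_⟩
  · rintro ⟨s, t, A, hA, f, g, hf, hgm, -, -, hM⟩
    obtain ⟨hs, ht⟩ := hk _ hA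
    simp only at hs ht
    obtain ⟨g', hg', hg'Y, hg'M⟩ := hg t ht g hgm
    refine hno ⟨s, t, A, hA, fun a => z ⟨a, by omega⟩ (ρ (f a)), g', fun a a' haa => ?_, hg',
      fun a => hzX _ _, fun b => (hg'Y b).1, fun a b => ?_⟩
    · by_contra hne
      exact hz _ _ _ _ (by simpa [Fin.ext_iff] using hne) (hf.ne hne) haa
    · rw [hzD _ _ _ (hg'Y b).2, hg'M, ← hM]
  · set U := univ.filter fun c => ∃ i, M (x i) c ≠ M (x i) (π c) with hU
    have h1 : entryDist M N ≤ ∑ i, ((rowDiff M i (x (ρ i))).card + U.card) := by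
      unfold entryDist
      rw [card_filter, Fintype.sum_prod_type]
      refine sum_le_sum fun i _ => ?_
      rw [← card_filter]
      refine (card_le_card fun c hc => ?_).trans (card_union_le _ _)
      by_contra hcn
      simp only [mem_union, rowDiff, mem_filter, mem_univ, true_and, not_or, ne_eq, not_not, hU,
        not_exists] at hcn
      simp only [mem_filter, mem_univ, true_and, N] at hc
      exact hc (hcn.1.trans (hcn.2 _))
    rw [sum_add_distrib, sum_const, card_univ, Fintype.card_fin, smul_eq_mul] at h1
    have h2 : m * (4 * e * U.card) ≤ m * n := Nat.mul_le_mul_left _ hπ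
    have h3 := Nat.mul_le_mul_left (4 * e) h1
    linarith

/-- Union bound over pairs: a random column separates a given far pair with probability at least
1/a. -/
theorem unifProb_not_separated_le {N p a : ℕ} (ha : 0 < a) (hn : 0 < n)
    (M : Matrix (Fin m) (Fin n) (Fin 2)) (x : Fin N → Fin m)
    (hx : ∀ i i', i ≠ i' → RowsFar a M (x i) (x i')) :
    unifProb (fun y : Fin p → Fin n => ∃ ii : Fin N × Fin N, ii.1 ≠ ii.2 ∧
      ∀ j, M (x ii.1) (y j) = M (x ii.2) (y j)) ≤ (N : ℝ) ^ 2 * Real.exp (-(p / a : ℝ)) := by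
  classical
  have : Nonempty (Fin n) := ⟨⟨0, hn⟩⟩
  have haR : (0 : ℝ) < a := by exact_mod_cast ha
  refine (unifProb_exists_le_mul (c := Real.exp (-(p / a : ℝ))) _ fun ii => ?_).trans (le_of_eq ?_)
  · by_cases hne : ii.1 = ii.2
    · simp only [hne, ne_eq, not_true_eq_false, false_and]
      simp [unifProb_eq]
      positivity
    · refine (unifProb_mono (q := fun y : Fin p → Fin n => ∀ j, y j ∉ rowDiff M (x ii.1) (x ii.2))
        fun y hy j => ?_).trans ?_
      · simpa [rowDiff] using hy.2 j
      · refine (unifProb_miss_le p _ (β := 1 / a) ?_).trans (le_of_eq ?_)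
        · have h1 := hx _ _ hne
          rw [RowsFar] at h1
          rw [Fintype.card_fin, one_div, inv_mul_le_iff₀ haR]
          exact_mod_cast h1
        · congr 2
          ring
  · simp [sq]

/-- The number of random columns that separate all rows from a set of rows that are pairwise at
relative distance at least `1 / a` and as many as `separationSize k a` columns can distinguish
without creating all patterns. -/
def separationSize (k a : ℕ) : ℕ :=
  400 * k * 2 ^ (4 * k) * (4 * k + 1).factorial * a ^ (4 * k + 1)

/-- The clique size depends on p itself, but its square grows only like p^(4k), which the term of
degree 4k + 1 of the exponential series of p/a dominates. -/
theorem separationSize_spec {k a : ℕ} (hk : 0 < k) (ha : 0 < a) :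
    ((((separationSize k a + 1) ^ (2 * k) + 1 : ℕ) : ℝ)) ^ 2 *
      Real.exp (-(separationSize k a / a : ℝ)) ≤ 1 / (100 * k) := by
  have hp : 0 < separationSize k a := by unfold separationSize; positivity
  set p := separationSize k a with hpdef
  have hpR : (1 : ℝ) ≤ p := by exact_mod_cast hp
  have hpR0 : (0 : ℝ) < p := by linarith
  have haR : (0 : ℝ) < a := by exact_mod_cast ha
  have hkR : (0 : ℝ) < k := by exact_mod_cast hk
  have h1 : (((p + 1) ^ (2 * k) + 1 : ℕ) : ℝ) ^ 2 ≤ 4 * 2 ^ (4 * k) * (p : ℝ) ^ (4 * k) := by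
    have h2 : (((p + 1) ^ (2 * k) + 1 : ℕ) : ℝ) ≤ 2 * (2 * p) ^ (2 * k) := by
      push_cast
      have h3 : ((p : ℝ) + 1) ^ (2 * k) ≤ (2 * p) ^ (2 * k) := by
        gcongr
        linarith
      have h4 : (1 : ℝ) ≤ (2 * p) ^ (2 * k) := one_le_pow₀ (by linarith)
      linarith
    calc _ ≤ (2 * (2 * (p : ℝ)) ^ (2 * k)) ^ 2 := by gcongr
      _ = _ := by
        rw [mul_pow, ← pow_mul, mul_pow, show 2 * k * 2 = 4 * k by ring]
        norm_num
        ring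
  have h5 := Real.pow_div_factorial_le_exp (p / a : ℝ) (by positivity) (4 * k + 1)
  have hfac : (0 : ℝ) < (4 * k + 1).factorial := by exact_mod_cast Nat.factorial_pos _
  rw [Real.exp_neg, ← div_eq_mul_inv, div_le_div_iff₀ (Real.exp_pos _) (by positivity), one_mul]
  refine le_trans ?_ h5
  rw [div_pow, le_div_iff₀ hfac, le_div_iff₀ (by positivity)]
  calc _ ≤ 4 * 2 ^ (4 * k) * (p : ℝ) ^ (4 * k) * (100 * k) * (4 * k + 1).factorial *
        (a : ℝ) ^ (4 * k + 1) := by gcongr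
    _ = (p : ℝ) ^ (4 * k) *
        (400 * k * 2 ^ (4 * k) * (4 * k + 1).factorial * (a : ℝ) ^ (4 * k + 1)) := by ring
    _ = (p : ℝ) ^ (4 * k) * p := by
        congr 1
        rw [hpdef, separationSize]
        push_cast
        ring
    _ = _ := by ring

/-- The random columns usually make the clique rows pairwise distinct, which are then too many to
avoid a copy. The factor 1/k leaves room for a union bound over k batches. -/
theorem unifProb_clique_le {k a p q : ℕ} (hk : SizesLE F k) (hF : F.Nonempty) (hk0 : 0 < k)
    (ha : 0 < a) (hn : 0 < n) (hp : p = separationSize k a) (M : Matrix (Fin m) (Fin n) (Fin 2))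
    (x : Fin q → Fin m) :
    unifProb (fun y : Fin p → Fin n => HasClique (RowsFar a M) ((p + 1) ^ (2 * k) + 1) x ∧
      ¬ HasCopy F M (univ.image x) (univ.image y)) ≤ 1 / (100 * k) := by
  classical
  by_cases hcl : HasClique (RowsFar a M) ((p + 1) ^ (2 * k) + 1) x
  · obtain ⟨d, hd⟩ := hcl
    refine (unifProb_mono fun y hy => ?_).trans
      ((unifProb_not_separated_le (p := p) ha hn M (fun i => x (d i)) hd).trans
        (hp ▸ separationSize_spec hk0 ha))
    by_contra! hsep
    exact hy.2 (hasCopy_of_rows hk hF (fun i => x (d i)) (by simp) y (by simp)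
      (Nat.lt_succ_self _) fun i i' hii => hsep (i, i') hii)
  · simp only [hcl, false_and]
    simp [unifProb_eq]

/-- `D` collects the columns in which a representative differs from one of its substitutes: k * q₁
pairs with fewer than n/A columns each, hence none at all if n ≤ A. Uncovered rows and covered rows
each cost at most 1/(4e) of the entries. -/
theorem rowsGood_of_covered {k e q₁ q₂ A : ℕ} {M : Matrix (Fin m) (Fin n) (Fin 2)}
    {x : Fin q₁ → Fin m} {x' : Fin k → Fin q₂ → Fin m} {X : Finset (Fin m)} (hk0 : 0 < k)
    (hq₁ : 0 < q₁) (hm : 0 < m)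
    (hA : 16 * e * k * q₁ ≤ A) (he : 0 < e) (hX : ∀ b j, x' b j ∈ X)
    (hunc : (unifProb fun v => ∀ l, RowsFar (4 * e) M v (x l)) < 1 / (4 * e : ℝ))
    (hx' : ∀ b l, ∃ j, ¬ RowsFar A M (x l) (x' b j))
    (hinj : ∀ b b' j j', b ≠ b' → x' b j ≠ x' b' j') :
    ∃ D : Finset (Fin n), RowsGood k e M x X D ∧ 16 * e * D.card ≤ n ∧ (n ≤ A → D = ∅) := by
  classical
  choose j hj using hx'
  let D : Finset (Fin n) :=
    univ.biUnion fun bl : Fin k × Fin q₁ => rowDiff M (x bl.2) (x' bl.1 (j bl.1 bl.2))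
  have hD1 : ∀ b l, A * (rowDiff M (x l) (x' b (j b l))).card < n := fun b l => by
    simpa [RowsFar] using hj b l
  -- Rows far from all representatives receive an arbitrary one.
  have hρ : ∀ v, ∃ l, (∀ l, RowsFar (4 * e) M v (x l)) ∨ ¬ RowsFar (4 * e) M v (x l) := fun v => by
    by_cases h : ∀ l, RowsFar (4 * e) M v (x l)
    · exact ⟨⟨0, hq₁⟩, Or.inl h⟩
    · push Not at h
      obtain ⟨l, hl⟩ := h
      exact ⟨l, Or.inr hl⟩
  choose ρ hρ using hρ
  refine ⟨D, ⟨ρ, fun b l => x' b (j b l), fun b l => hX _ _, fun b b' i i' hb _ => hinj _ _ _ _ hb,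
    fun b l c hc => ?_, ?_⟩, ?_, fun hnA => ?_⟩
  · by_contra hne
    exact hc (mem_biUnion.2 ⟨(b, l), mem_univ _, by simpa [rowDiff] using Ne.symm hne⟩)
  · set U := univ.filter fun v => ∀ l, RowsFar (4 * e) M v (x l) with hU
    have hUc : 4 * e * U.card ≤ m := by
      have hmR : (0 : ℝ) < m := by exact_mod_cast hm
      have heR : (0 : ℝ) < e := by exact_mod_cast he
      rw [unifProb_eq, div_lt_div_iff₀ (by simpa using hmR) (by positivity), Fintype.card_fin,
        one_mul] at hunc
      have : (4 * e * U.card : ℝ) ≤ m := by linarith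
      exact_mod_cast this
    have hrow : ∀ v, 4 * e * (rowDiff M v (x (ρ v))).card ≤
        n + 4 * e * n * (if v ∈ U then 1 else 0) := fun v => by
      by_cases hv : v ∈ U
      · have : (rowDiff M v (x (ρ v))).card ≤ n := by
          simpa using card_le_univ (rowDiff M v (x (ρ v)))
        have := Nat.mul_le_mul_left (4 * e) this
        simp only [hv, if_true, mul_one]
        omega
      · have h1 := (hρ v).resolve_left (by simpa [hU] using hv)
        rw [RowsFar, not_le] at h1
        simp only [hv, if_false, mul_zero, add_zero]
        exact h1.le
    have hsum := sum_le_sum fun v (_ : v ∈ univ) => hrow v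
    rw [← mul_sum, sum_add_distrib, ← mul_sum, sum_const, card_univ, Fintype.card_fin, smul_eq_mul,
      ← card_filter, filter_mem_eq_inter, univ_inter] at hsum
    have := Nat.mul_le_mul_left n hUc
    linarith
  · have h1 : D.card * A ≤ k * q₁ * n := by
      calc D.card * A ≤ (∑ bl : Fin k × Fin q₁,
            (rowDiff M (x bl.2) (x' bl.1 (j bl.1 bl.2))).card) * A :=
          Nat.mul_le_mul_right _ card_biUnion_le
        _ ≤ ∑ _bl : Fin k × Fin q₁, n := by
          rw [sum_mul]
          exact sum_le_sum fun bl _ => by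
            rw [mul_comm]
            exact (hD1 _ _).le
        _ = _ := by simp
    have h2 : D.card * (16 * e * k * q₁) ≤ k * q₁ * n := (Nat.mul_le_mul_left _ hA).trans h1
    have h3 : 0 < k * q₁ := by positivity
    refine Nat.le_of_mul_le_mul_left ?_ h3
    linarith
  · rw [eq_empty_iff_forall_notMem]
    intro c hc
    obtain ⟨bl, -, hbl⟩ := mem_biUnion.1 hc
    have h1 := hD1 bl.1 bl.2
    have h2 : 0 < (rowDiff M (x bl.2) (x' bl.1 (j bl.1 bl.2))).card := card_pos.2 ⟨c, hbl⟩
    have := Nat.le_mul_of_pos_right A h2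
    omega

end Rows

end FinMatrix

namespace FinMatrix

/-! ### Random rows are usually good -/

section Rows

open Finset

variable {F : Set (FinMatrix (Fin 2))} {m n : ℕ}

/-- The rows in a sample that consists of several batches. -/
def sampledRows {k q₁ q₂ : ℕ} (x : (Fin q₁ → Fin m) × (Fin k → Fin q₂ → Fin m)) :
    Finset (Fin m) :=
  univ.image x.1 ∪ univ.biUnion fun b => univ.image (x.2 b)

theorem image_fst_subset_sampledRows {k q₁ q₂ : ℕ}
    (x : (Fin q₁ → Fin m) × (Fin k → Fin q₂ → Fin m)) : univ.image x.1 ⊆ sampledRows x :=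
  subset_union_left

theorem image_snd_subset_sampledRows {k q₁ q₂ : ℕ}
    (x : (Fin q₁ → Fin m) × (Fin k → Fin q₂ → Fin m)) (b : Fin k) :
    univ.image (x.2 b) ⊆ sampledRows x :=
  (subset_biUnion_of_mem (fun b => univ.image (x.2 b)) (mem_univ b)).trans subset_union_right

theorem card_sampledRows_le {k q₁ q₂ : ℕ} (x : (Fin q₁ → Fin m) × (Fin k → Fin q₂ → Fin m)) :
    (sampledRows x).card ≤ q₁ + k * q₂ := by
  refine (card_union_le _ _).trans (Nat.add_le_add (card_image_le.trans (by simp)) ?_)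
  refine (card_biUnion_le_card_mul _ _ q₂ fun b _ => card_image_le.trans (by simp)).trans ?_
  simp

/-- A representative is a uniform row independent of each batch, so `unifProb_far_le` applies to
each of the k * q₁ pairs. -/
theorem unifProb_no_partner_le {k q₁ q₂ N : ℕ} [Nonempty (Fin m)] (far : Fin m → Fin m → Prop)
    (hirr : ∀ v, ¬ far v v) (hq₂ : q₂ = 100 * k * q₁ * N) :
    unifProb (fun x : (Fin q₁ → Fin m) × (Fin k → Fin q₂ → Fin m) => ∃ bl : Fin k × Fin q₁,
      (∀ j, far (x.1 bl.2) (x.2 bl.1 j)) ∧ ¬ HasClique far N (x.2 bl.1)) ≤ 1 / 100 := by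
  refine (unifProb_exists_le_mul (c := N / (q₂ + 1 : ℝ)) _ fun bl => ?_).trans ?_
  · have hb : Balanced fun x : (Fin q₁ → Fin m) × (Fin k → Fin q₂ → Fin m) =>
        (x.1 bl.2, x.2 bl.1) :=
      Balanced.prodMap (φ := fun u : Fin q₁ → Fin m => u bl.2)
        (ψ := fun u : Fin k → Fin q₂ → Fin m => u bl.1) (balanced_eval _) (balanced_eval _)
    have h := hb fun ω => (∀ j, far ω.1 (ω.2 j)) ∧ ¬ HasClique far N ω.2
    exact h.le.trans (unifProb_far_le far hirr N q₂)
  · have hq : (q₂ : ℝ) = 100 * k * q₁ * N := by exact_mod_cast hq₂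
    simp only [Fintype.card_prod, Fintype.card_fin]
    rw [← mul_div_assoc, div_le_div_iff₀ (by positivity) (by norm_num), hq]
    push_cast
    linarith

/-- Birthday bound: it makes substitutes from different batches distinct. -/
theorem unifProb_repeat_le {k q : ℕ} [Nonempty (Fin m)] (hm : 100 * k ^ 2 * q ^ 2 ≤ m) :
    unifProb (fun x : Fin k → Fin q → Fin m => ∃ c : (Fin k × Fin q) × (Fin k × Fin q),
      c.1.1 ≠ c.2.1 ∧ x c.1.1 c.1.2 = x c.2.1 c.2.2) ≤ 1 / 100 := by
  have hmR : (0 : ℝ) < m := by exact_mod_cast Fin.pos_iff_nonempty.2 ‹_›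
  refine (unifProb_exists_le_mul (c := 1 / (m : ℝ)) _ fun c => ?_).trans ?_
  · by_cases hc : c.1.1 = c.2.1
    · simp only [hc, ne_eq, not_true_eq_false, false_and]
      simp [unifProb_eq]
    · refine (unifProb_mono fun x hx => hx.2).trans ?_
      have h := unifProb_eval_eq (V := Fin m) _ _ hc c.1.2 c.2.2
      rwa [Fintype.card_fin] at h
  · simp only [Fintype.card_prod, Fintype.card_fin]
    rw [mul_one_div, div_le_div_iff₀ hmR (by norm_num)]
    have : (100 * k ^ 2 * q ^ 2 : ℝ) ≤ m := by exact_mod_cast hm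
    push_cast
    linarith

/-- Random rows `x` contain, together with random columns `y`, a copy of a member of `F`, or else
are usually good. -/
theorem unifProb_not_rowsGood_le {k e p₁ p₂ q₁ q₂ A : ℕ} (hk : SizesLE F k) (hF : F.Nonempty)
    (hk0 : 0 < k) (M : Matrix (Fin m) (Fin n) (Fin 2)) (hm0 : 0 < m) (hn : 0 < n) (he : 0 < e)
    (hp₁ : p₁ = separationSize k (4 * e)) (hq₁ : q₁ = 400 * e * ((p₁ + 1) ^ (2 * k) + 1))
    (hA : 16 * e * k * q₁ ≤ A) (hp₂ : p₂ = separationSize k A)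
    (hq₂ : q₂ = 100 * k * q₁ * ((p₂ + 1) ^ (2 * k) + 1)) (hm : 100 * k ^ 2 * q₂ ^ 2 ≤ m) :
    unifProb (fun ω : ((Fin q₁ → Fin m) × (Fin k → Fin q₂ → Fin m)) ×
        ((Fin p₁ → Fin n) × (Fin p₂ → Fin n)) =>
      ¬ HasCopy F M (sampledRows ω.1) (univ.image ω.2.1 ∪ univ.image ω.2.2) ∧
      ¬ ∃ D, RowsGood k e M ω.1.1 (sampledRows ω.1) D ∧ 16 * e * D.card ≤ n ∧
        (n ≤ A → D = ∅)) ≤ 5 / 100 := by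
  classical
  have : Nonempty (Fin n) := ⟨⟨0, hn⟩⟩
  have : Nonempty (Fin m) := ⟨⟨0, hm0⟩⟩
  have hq₁0 : 0 < q₁ := by rw [hq₁]; positivity
  have hA0 : 0 < A := lt_of_lt_of_le (by positivity) hA
  have hkR : (0 : ℝ) < k := by exact_mod_cast hk0
  have heR : (0 : ℝ) < e := by exact_mod_cast he
  have hmR : (0 : ℝ) < m := by exact_mod_cast hm0
  have hq₁R : (0 : ℝ) < q₁ := by exact_mod_cast hq₁0
  have hk1 : (1 : ℝ) ≤ k := by exact_mod_cast hk0
  set N₁ := (p₁ + 1) ^ (2 * k) + 1 with hN₁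
  set N₂ := (p₂ + 1) ^ (2 * k) + 1 with hN₂
  let Ωr := (Fin q₁ → Fin m) × (Fin k → Fin q₂ → Fin m)
  let Ωc := (Fin p₁ → Fin n) × (Fin p₂ → Fin n)
  -- The bad events, each of probability at most 1/100: a clique of representatives or of a batch
  -- that yields no copy (E₁, E₂), too many uncovered rows (E₃), a representative without substitute
  -- in some batch (E₄), and a row common to two batches (E₅).
  let E₁ : Ωr → Ωc → Prop := fun x y => HasClique (RowsFar (4 * e) M) N₁ x.1 ∧
    ¬ HasCopy F M (univ.image x.1) (univ.image y.1)
  let E₂ : Ωr → Ωc → Prop := fun x y => ∃ b, HasClique (RowsFar A M) N₂ (x.2 b) ∧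
    ¬ HasCopy F M (univ.image (x.2 b)) (univ.image y.2)
  let E₃ : (Fin q₁ → Fin m) → Prop := fun x => ¬ HasClique (RowsFar (4 * e) M) N₁ x ∧
    1 / (4 * e : ℝ) ≤ unifProb fun v => ∀ l, RowsFar (4 * e) M v (x l)
  let E₄ : Ωr → Prop := fun x => ∃ bl : Fin k × Fin q₁,
    (∀ j, RowsFar A M (x.1 bl.2) (x.2 bl.1 j)) ∧ ¬ HasClique (RowsFar A M) N₂ (x.2 bl.1)
  let E₅ : (Fin k → Fin q₂ → Fin m) → Prop := fun x =>
    ∃ c : (Fin k × Fin q₂) × (Fin k × Fin q₂), c.1.1 ≠ c.2.1 ∧ x c.1.1 c.1.2 = x c.2.1 c.2.2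
  have h1 : unifProb (fun ω : Ωr × Ωc => E₁ ω.1 ω.2) ≤ 1 / 100 := by
    refine unifProb_prod_le (by norm_num) fun x => ?_
    have h := unifProb_clique_le hk hF hk0 (by positivity) hn hp₁ M x.1
    have hb := balanced_fst (Ω := Fin p₁ → Fin n) (Ω' := Fin p₂ → Fin n)
      (fun z => HasClique (RowsFar (4 * e) M) N₁ x.1 ∧
        ¬ HasCopy F M (univ.image x.1) (univ.image z))
    refine hb.le.trans (h.trans ?_)
    gcongr
    linarith
  have h2 : unifProb (fun ω : Ωr × Ωc => E₂ ω.1 ω.2) ≤ 1 / 100 := by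
    refine unifProb_prod_le (by norm_num) fun x => ?_
    refine (unifProb_exists_le_mul (c := 1 / (100 * k)) _ fun b => ?_).trans (le_of_eq ?_)
    · have h := unifProb_clique_le hk hF hk0 hA0 hn hp₂ M (x.2 b)
      have hb := balanced_snd (Ω := Fin p₁ → Fin n) (Ω' := Fin p₂ → Fin n)
        (fun z => HasClique (RowsFar A M) N₂ (x.2 b) ∧
          ¬ HasCopy F M (univ.image (x.2 b)) (univ.image z))
      exact hb.le.trans h
    · rw [Fintype.card_fin]
      field_simp
  have h3 : unifProb E₃ ≤ 1 / 100 := by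
    refine (unifProb_uncovered_le _ (not_rowsFar_self _ M hn) N₁ q₁ (by positivity)).trans ?_
    rw [hq₁]
    push_cast
    rw [div_le_div_iff₀ (by positivity) (by norm_num), add_mul,
      show (400 * e * (N₁ : ℝ)) * (1 / (4 * e)) = 100 * N₁ by field_simp; ring]
    have : (0 : ℝ) ≤ 1 * (1 / (4 * e)) := by positivity
    linarith
  have h4 : unifProb E₄ ≤ 1 / 100 :=
    unifProb_no_partner_le (RowsFar A M) (not_rowsFar_self _ M hn) hq₂
  have h5 : unifProb E₅ ≤ 1 / 100 := unifProb_repeat_le hm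
  have hsub : ∀ ω : Ωr × Ωc,
      (¬ HasCopy F M (sampledRows ω.1) (univ.image ω.2.1 ∪ univ.image ω.2.2) ∧
      ¬ ∃ D, RowsGood k e M ω.1.1 (sampledRows ω.1) D ∧ 16 * e * D.card ≤ n ∧
        (n ≤ A → D = ∅)) →
      (((E₁ ω.1 ω.2 ∨ E₂ ω.1 ω.2) ∨ E₃ ω.1.1) ∨ E₄ ω.1) ∨ E₅ ω.1.2 := by
    rintro ⟨x, y⟩ ⟨hno, hD⟩
    by_contra hE
    simp only [not_or] at hE
    obtain ⟨⟨⟨⟨n1, n2⟩, n3⟩, n4⟩, n5⟩ := hE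
    have c1 : ¬ HasClique (RowsFar (4 * e) M) N₁ x.1 := fun hc => n1 ⟨hc, fun hcopy =>
      hno (hcopy.mono (image_fst_subset_sampledRows x) subset_union_left)⟩
    have c2 : ∀ b, ¬ HasClique (RowsFar A M) N₂ (x.2 b) := fun b hc => n2 ⟨b, hc, fun hcopy =>
      hno (hcopy.mono (image_snd_subset_sampledRows x b) subset_union_right)⟩
    refine hD (rowsGood_of_covered hk0 hq₁0 hm0 hA he (x' := x.2)
      (fun b j => image_snd_subset_sampledRows x b (mem_image_of_mem _ (mem_univ j))) ?_
      (fun b l => ?_) fun b b' j j' hb heq => n5 ⟨((b, j), (b', j')), hb, heq⟩)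
    · by_contra! hlt
      exact n3 ⟨c1, hlt⟩
    · by_contra! hfar
      exact n4 ⟨(b, l), hfar, c2 b⟩
  have hbal : Balanced fun ω : Ωr × Ωc => ω.1 := balanced_fst
  have hbal1 : Balanced fun ω : Ωr × Ωc => ω.1.1 := balanced_fst.comp hbal
  have hbal2 : Balanced fun ω : Ωr × Ωc => ω.1.2 := balanced_snd.comp hbal
  refine (unifProb_mono hsub).trans ?_
  refine (unifProb_or_le _ _).trans ?_
  have g5 := (hbal2 E₅).le.trans h5
  have g4 := (hbal E₄).le.trans h4
  have g3 := (hbal1 E₃).le.trans h3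
  have i4 := unifProb_or_le (fun ω : Ωr × Ωc => (E₁ ω.1 ω.2 ∨ E₂ ω.1 ω.2) ∨ E₃ ω.1.1)
    (fun ω => E₄ ω.1)
  have i3 := unifProb_or_le (fun ω : Ωr × Ωc => E₁ ω.1 ω.2 ∨ E₂ ω.1 ω.2) (fun ω => E₃ ω.1.1)
  have i2 := unifProb_or_le (fun ω : Ωr × Ωc => E₁ ω.1 ω.2) (fun ω => E₂ ω.1 ω.2)
  linarith

/-- If there are few rows, then all of them can be read. -/
theorem rowsGood_univ {k e r : ℕ} (M : Matrix (Fin m) (Fin n) (Fin 2)) (x : Fin r → Fin m)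
    (hx : Function.Surjective x) : RowsGood k e M x univ ∅ := by
  choose ρ hρ using hx
  -- Every row is represented by itself, so distinct rows have distinct representatives and need no
  -- further substitutes.
  refine ⟨ρ, fun _ l => x l, by simp, fun b b' i i' _ hi => ?_, by simp, ?_⟩
  · simpa [hρ] using hi
  · simp [hρ, rowDiff]

end Rows

end FinMatrix

namespace FinMatrix

/-! ### Sample sizes and their polynomial growth -/

section SampleSizes

/-- The number of rows that represent most of the rows. -/
def coverSize (k e : ℕ) : ℕ := 400 * e * ((separationSize k (4 * e) + 1) ^ (2 * k) + 1)

/-- The number of columns that represent most of the columns, restricted to `r` rows. -/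
def letterSize (k e r : ℕ) : ℕ := 800 * e * ((r + 1) ^ (2 ^ (2 * k)) + 1)

/-- The number of columns below which all of them are read. -/
def columnThreshold (k e r : ℕ) : ℕ := 32 * e * k * letterSize k e r ^ k

/-- The number of random columns that hit all sets of columns of interest. -/
def hitSize (k e r : ℕ) : ℕ := 100 * k * letterSize k e r ^ k * columnThreshold k e r

/-- The inverse of the relative distance at which rows are substituted for each other. -/
def fineScale (k e : ℕ) : ℕ :=
  16 * e * k * coverSize k e + columnThreshold k e (coverSize k e)

/-- The number of random rows among which substitutes are found. -/
def partnerSize (k e : ℕ) : ℕ :=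
  100 * k * coverSize k e * ((separationSize k (fineScale k e) + 1) ^ (2 * k) + 1)

/-- The number of rows below which all of them are read. -/
def rowThreshold (k e : ℕ) : ℕ := 100 * k ^ 2 * partnerSize k e ^ 2

/-- The number of columns that are read when `r` rows represent all of them. -/
def columnBudget (k e r : ℕ) : ℕ := columnThreshold k e r + letterSize k e r + hitSize k e r

/-- A bound on the number of queries. -/
def queryBudget (k e : ℕ) : ℕ :=
  (coverSize k e + k * partnerSize k e + rowThreshold k e) *
    (separationSize k (4 * e) + separationSize k (fineScale k e) +
      columnBudget k e (coverSize k e) + columnBudget k e (rowThreshold k e))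

/-- Functions that are polynomials with natural coefficients. -/
def IsPolynomialFun (f : ℕ → ℕ) : Prop := ∃ P : Polynomial ℕ, ∀ e, f e = P.eval e

namespace IsPolynomialFun

variable {f g : ℕ → ℕ}

theorem const (c : ℕ) : IsPolynomialFun fun _ => c := ⟨Polynomial.C c, by simp⟩

theorem id : IsPolynomialFun fun e => e := ⟨Polynomial.X, by simp⟩

theorem add (hf : IsPolynomialFun f) (hg : IsPolynomialFun g) :
    IsPolynomialFun fun e => f e + g e := by
  obtain ⟨P, hP⟩ := hf
  obtain ⟨Q, hQ⟩ := hg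
  exact ⟨P + Q, by simp [hP, hQ]⟩

theorem mul (hf : IsPolynomialFun f) (hg : IsPolynomialFun g) :
    IsPolynomialFun fun e => f e * g e := by
  obtain ⟨P, hP⟩ := hf
  obtain ⟨Q, hQ⟩ := hg
  exact ⟨P * Q, by simp [hP, hQ]⟩

theorem pow (hf : IsPolynomialFun f) (d : ℕ) : IsPolynomialFun fun e => f e ^ d := by
  obtain ⟨P, hP⟩ := hf
  exact ⟨P ^ d, by simp [hP]⟩

variable (k : ℕ)

theorem separationSize (hf : IsPolynomialFun f) :
    IsPolynomialFun fun e => separationSize k (f e) :=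
  (const _).mul (hf.pow _)

theorem coverSize : IsPolynomialFun fun e => coverSize k e :=
  ((const 400).mul id).mul
    (((((const 4).mul id).separationSize k).add (const 1)).pow (2 * k) |>.add (const 1))

theorem letterSize (hf : IsPolynomialFun f) : IsPolynomialFun fun e => letterSize k e (f e) :=
  ((const 800).mul id).mul (((hf.add (const 1)).pow _).add (const 1))

theorem columnThreshold (hf : IsPolynomialFun f) :
    IsPolynomialFun fun e => columnThreshold k e (f e) :=
  (((const 32).mul id).mul (const k)).mul ((hf.letterSize k).pow k)

theorem hitSize (hf : IsPolynomialFun f) : IsPolynomialFun fun e => hitSize k e (f e) :=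
  (((const 100).mul (const k)).mul ((hf.letterSize k).pow k)).mul (hf.columnThreshold k)

theorem fineScale : IsPolynomialFun fun e => fineScale k e :=
  ((((const 16).mul id).mul (const k)).mul (coverSize k)).add
    ((coverSize k).columnThreshold k)

theorem partnerSize : IsPolynomialFun fun e => partnerSize k e :=
  (((const 100).mul (const k)).mul (coverSize k)).mul
    (((((fineScale k).separationSize k).add (const 1)).pow (2 * k)).add (const 1))

theorem rowThreshold : IsPolynomialFun fun e => rowThreshold k e :=
  ((const 100).mul ((const k).pow 2)).mul ((partnerSize k).pow 2)

theorem columnBudget (hf : IsPolynomialFun f) : IsPolynomialFun fun e => columnBudget k e (f e) :=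
  ((hf.columnThreshold k).add (hf.letterSize k)).add (hf.hitSize k)

theorem queryBudget : IsPolynomialFun fun e => queryBudget k e :=
  (((coverSize k).add ((const k).mul (partnerSize k))).add (rowThreshold k)).mul
    ((((((const 4).mul id).separationSize k).add ((fineScale k).separationSize k)).add
      ((coverSize k).columnBudget k)).add ((rowThreshold k).columnBudget k))

/-- A polynomial in `⌈x⌉` is at most a polynomial in `x`. -/
theorem exists_real_polynomial (hf : IsPolynomialFun f) :
    ∃ p : Polynomial ℝ, ∀ x : ℝ, 0 ≤ x → (f ⌈x⌉₊ : ℝ) ≤ p.eval x := by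
  obtain ⟨P, hP⟩ := hf
  refine ⟨(P.map (Nat.castRingHom ℝ)).comp (Polynomial.X + 1), fun x hx => ?_⟩
  have h1 : ((P.eval ⌈x⌉₊ : ℕ) : ℝ) = (P.map (Nat.castRingHom ℝ)).eval (⌈x⌉₊ : ℝ) := by
    rw [Polynomial.eval_natCast_map]
    simp
  -- The coefficients are nonnegative, so ⌈x⌉ may be replaced by the upper bound x + 1.
  rw [hP, h1, Polynomial.eval_comp, Polynomial.eval_eq_sum_range, Polynomial.eval_eq_sum_range]
  refine Finset.sum_le_sum fun i _ => ?_
  have h2 := (Nat.ceil_lt_add_one hx).le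
  have h3 : (0 : ℝ) ≤ (P.map (Nat.castRingHom ℝ)).coeff i := by
    rw [Polynomial.coeff_map]
    exact Nat.cast_nonneg _
  simp only [Polynomial.eval_add, Polynomial.eval_X, Polynomial.eval_one]
  gcongr

end IsPolynomialFun

end SampleSizes

/-! ### Assembling the tester -/

section Main

open Finset

variable {F : Set (FinMatrix (Fin 2))} {m n : ℕ} {ε : ℝ} {k e : ℕ}

theorem not_mem_freeness_of_isFar {M : Matrix (Fin m) (Fin n) (Fin 2)} (hm : 0 < m) (hn : 0 < n)
    (hε : 0 < ε) (hM : IsFar (freeness F) ε M) : (⟨m, n, M⟩ : FinMatrix (Fin 2)) ∉ freeness F := by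
  intro h
  have h1 := hM M h
  have h2 : entryDist M M = 0 := by simp [entryDist]
  rw [h2] at h1
  have : 0 < ε * ((m : ℝ) * n) := by positivity
  simp only [Nat.cast_zero] at h1
  linarith

/-- Otherwise `exists_close_of_good` gives a member at relative distance at most 3/(4e), less than
ε. -/
theorem hasCopy_of_isFar {r : ℕ} (hk : SizesLE F k) (hm : 0 < m) (hn : 0 < n) (hε : 1 ≤ e * ε)
    {M : Matrix (Fin m) (Fin n) (Fin 2)} (hM : IsFar (freeness F) ε M) {x : Fin r → Fin m}
    {X : Finset (Fin m)} {D Y : Finset (Fin n)} (hR : RowsGood k e M x X D)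
    (hC : ColumnsGood k e M x D Y) : HasCopy F M X Y := by
  by_contra hno
  obtain ⟨N, hN, hd⟩ := exists_close_of_good hk hR hC hno
  have h1 := hM N hN
  have h2 : (4 * e * entryDist M N : ℝ) ≤ 3 * (m * n) := by exact_mod_cast hd
  have h3 : (0 : ℝ) < m * n := by positivity
  have h4 : (e : ℝ) * (ε * (m * n)) ≤ e * entryDist M N := by gcongr
  nlinarith

/-- The test for matrices with many rows. -/
theorem unifProb_not_hasCopy_le_of_many_rows (hk : SizesLE F k) (hF : F.Nonempty) (hk0 : 0 < k)
    (hm : 0 < m) (hn : 0 < n) (he : 0 < e) (hε : 1 ≤ e * ε) (hmk : rowThreshold k e ≤ m)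
    {M : Matrix (Fin m) (Fin n) (Fin 2)} (hM : IsFar (freeness F) ε M)
    (Y : (Fin (letterSize k e (coverSize k e)) → Fin n) ×
      (Fin (hitSize k e (coverSize k e)) → Fin n) →
      (Fin (separationSize k (4 * e)) → Fin n) × (Fin (separationSize k (fineScale k e)) → Fin n) →
      Finset (Fin n))
    (hY1 : ∀ y z, univ.image y.1 ⊆ Y y z ∧ univ.image y.2 ⊆ Y y z ∧
      univ.image z.1 ∪ univ.image z.2 ⊆ Y y z)
    (hY2 : n < columnThreshold k e (coverSize k e) → ∀ y z, Y y z = univ) :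
    unifProb (fun ω : (((Fin (coverSize k e) → Fin m) ×
      (Fin k → Fin (partnerSize k e) → Fin m)) × ((Fin (separationSize k (4 * e)) → Fin n) ×
        (Fin (separationSize k (fineScale k e)) → Fin n))) ×
      ((Fin (letterSize k e (coverSize k e)) → Fin n) ×
        (Fin (hitSize k e (coverSize k e)) → Fin n)) =>
      ¬ HasCopy F M (sampledRows ω.1.1) (Y ω.2 ω.1.2)) ≤ 1 / 3 := by
  classical
  have : Nonempty (Fin n) := ⟨⟨0, hn⟩⟩
  let Ωr := (Fin (coverSize k e) → Fin m) × (Fin k → Fin (partnerSize k e) → Fin m)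
  let Ωz := (Fin (separationSize k (4 * e)) → Fin n) ×
    (Fin (separationSize k (fineScale k e)) → Fin n)
  let Ωy := (Fin (letterSize k e (coverSize k e)) → Fin n) ×
    (Fin (hitSize k e (coverSize k e)) → Fin n)
  let Good : Ωr → Finset (Fin n) → Prop := fun x D => RowsGood k e M x.1 (sampledRows x) D ∧
    16 * e * D.card ≤ n ∧ (n ≤ fineScale k e → D = ∅)
  -- `D` is fixed as a function of the rows alone, so the columns `y` drawn for `ColumnsGood` are
  -- independent of it.
  have hD : ∀ x, ∃ D, (∃ D', Good x D') → Good x D := fun x => by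
    by_cases h : ∃ D', Good x D'
    · obtain ⟨D, hD⟩ := h
      exact ⟨D, fun _ => hD⟩
    · exact ⟨∅, fun h' => (h h').elim⟩
  choose D hD using hD
  let E₁ : Ωr × Ωz → Prop := fun ω =>
    ¬ HasCopy F M (sampledRows ω.1) (univ.image ω.2.1 ∪ univ.image ω.2.2) ∧ ¬ ∃ D, Good ω.1 D
  let E₂ : Ωr × Ωz → Ωy → Prop := fun x y => (columnThreshold k e (coverSize k e) ≤ n ∧
    Good x.1 (D x.1)) ∧ ¬ HasCopy F M (univ.image x.1.1) (univ.image y.1) ∧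
      ¬ ColumnsGood k e M x.1.1 (D x.1) (univ.image y.2)
  have h1 : unifProb E₁ ≤ 5 / 100 :=
    unifProb_not_rowsGood_le hk hF hk0 M hm hn he rfl rfl (Nat.le_add_right _ _) rfl rfl hmk
  have h2 : unifProb (fun ω : (Ωr × Ωz) × Ωy => E₂ ω.1 ω.2) ≤ 2 / 100 := by
    refine unifProb_prod_le (by norm_num) fun x => ?_
    by_cases hx : columnThreshold k e (coverSize k e) ≤ n ∧ Good x.1 (D x.1)
    · refine (unifProb_mono fun y hy => hy.2).trans ?_
      exact unifProb_not_columnsGood_le hk hF hk0 M x.1.1 (D x.1) hn he rfl rfl hx.1 rfl hx.2.2.1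
    · simp only [E₂, hx, false_and]
      rw [unifProb_eq]
      norm_num
  have hsub : ∀ ω : (Ωr × Ωz) × Ωy, ¬ HasCopy F M (sampledRows ω.1.1) (Y ω.2 ω.1.2) →
      E₁ ω.1 ∨ E₂ ω.1 ω.2 := by
    rintro ⟨⟨x, z⟩, y⟩ hno
    by_contra hE
    rw [not_or] at hE
    obtain ⟨n1, n2⟩ := hE
    obtain ⟨s1, s2, s3⟩ := hY1 y z
    have hgood : Good x (D x) := hD x (by
      by_contra hx
      exact n1 ⟨fun hc => hno (hc.mono subset_rfl s3), hx⟩)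
    refine hno (hasCopy_of_isFar hk hm hn hε hM hgood.1 ?_)
    -- The second summand of `fineScale` makes `D` empty when there are too few columns to sample;
    -- all columns are then read.
    by_cases hlt : n < columnThreshold k e (coverSize k e)
    · rw [hgood.2.2 (hlt.le.trans (Nat.le_add_left _ _)), hY2 hlt]
      exact columnsGood_univ k e M x.1
    · by_contra hcol
      exact n2 ⟨⟨not_lt.1 hlt, hgood⟩,
        fun hc => hno (hc.mono (image_fst_subset_sampledRows x) s1), fun hc => hcol (hc.mono s2)⟩
  have hbal : Balanced fun ω : (Ωr × Ωz) × Ωy => ω.1 := balanced_fst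
  have h3 := (hbal E₁).le.trans h1
  have h4 := unifProb_or_le (fun ω : (Ωr × Ωz) × Ωy => E₁ ω.1) fun ω => E₂ ω.1 ω.2
  have h5 := unifProb_mono hsub
  linarith

theorem card_image_univ_le {q : ℕ} (y : Fin q → Fin n) : (univ.image y).card ≤ q :=
  card_image_le.trans (by simp)

theorem exists_surjective_of_le {r : ℕ} (hm : 0 < m) (h : m ≤ r) :
    ∃ x : Fin r → Fin m, Function.Surjective x :=
  ⟨fun i => if hi : i.1 < m then ⟨i, hi⟩ else ⟨0, hm⟩, fun j => ⟨⟨j, by omega⟩, by simp⟩⟩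

/-- On matrices of a given size, polynomially many queries suffice. -/
theorem exists_test_queryBudget (hk : SizesLE F k) (hk0 : 0 < k)
    (hrow : ClosedUnderRowPermutations F) (hm : 0 < m) (hn : 0 < n) (he : 0 < e) (hε0 : 0 < ε)
    (hε : 1 ≤ e * ε) :
    ∃ T : PMF (QueryAlg (Fin 2) m n), (∀ M : Matrix (Fin m) (Fin n) (Fin 2),
      ((⟨m, n, M⟩ : FinMatrix (Fin 2)) ∈ freeness F →
        (T.map fun t => t.output M) true = 1 ∧ (T.map fun t => t.output M) false ≤ 1 / 3) ∧
      (IsFar (freeness F) ε M → (T.map fun t => t.output M) true ≤ 1 / 3)) ∧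
      ∀ M, ∀ t ∈ T.support, t.queries M ≤ queryBudget k e := by
  classical
  have : Nonempty (Fin n) := ⟨⟨0, hn⟩⟩
  have : Nonempty (Fin m) := ⟨⟨0, hm⟩⟩
  rcases F.eq_empty_or_nonempty with rfl | hF
  · refine exists_test hrow (Ω := Unit) (fun _ => ∅) (fun _ => ∅) (by simp) fun M hM => ?_
    exact (not_mem_freeness_of_isFar hm hn hε0 hM (by simp [freeness])).elim
  rcases le_or_gt (rowThreshold k e) m with hmk | hmk
  · let Y : (Fin (letterSize k e (coverSize k e)) → Fin n) ×
        (Fin (hitSize k e (coverSize k e)) → Fin n) →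
        (Fin (separationSize k (4 * e)) → Fin n) ×
        (Fin (separationSize k (fineScale k e)) → Fin n) → Finset (Fin n) := fun y z =>
      if n < columnThreshold k e (coverSize k e) then univ else
        (univ.image y.1 ∪ univ.image y.2) ∪ (univ.image z.1 ∪ univ.image z.2)
    refine exists_test hrow _ _ (fun ω => ?_) fun M hM =>
      unifProb_not_hasCopy_le_of_many_rows hk hF hk0 hm hn he hε hmk hM Y (fun y z => ?_)
        fun hlt y z => ?_
    · have h1 := card_sampledRows_le ω.1.1
      have h2 : (Y ω.2 ω.1.2).card ≤ separationSize k (4 * e) + separationSize k (fineScale k e) +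
          columnBudget k e (coverSize k e) := by
        simp only [Y, columnBudget]
        split_ifs with hlt
        · rw [card_univ, Fintype.card_fin]
          omega
        · have c1 := card_union_le (univ.image ω.2.1 ∪ univ.image ω.2.2)
            (univ.image ω.1.2.1 ∪ univ.image ω.1.2.2)
          have c2 := card_union_le (univ.image ω.2.1) (univ.image ω.2.2)
          have c3 := card_union_le (univ.image ω.1.2.1) (univ.image ω.1.2.2)
          have := card_image_univ_le ω.2.1
          have := card_image_univ_le ω.2.2
          have := card_image_univ_le ω.1.2.1
          have := card_image_univ_le ω.1.2.2
          omega
      exact Nat.mul_le_mul (h1.trans (Nat.le_add_right _ _)) (h2.trans (Nat.le_add_right _ _))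
    · simp only [Y]
      split_ifs
      · exact ⟨subset_univ _, subset_univ _, subset_univ _⟩
      · exact ⟨subset_union_left.trans subset_union_left,
          subset_union_right.trans subset_union_left, subset_union_right⟩
    · simp [Y, hlt]
  -- With few rows, all rows serve as representatives, with repetitions to reach `rowThreshold k e`
  -- of them.
  obtain ⟨x, hx⟩ := exists_surjective_of_le hm hmk.le
  rcases lt_or_ge n (columnThreshold k e (rowThreshold k e)) with hnk | hnk
  · refine exists_test hrow (Ω := Unit) (fun _ => univ) (fun _ => univ) (fun _ => ?_)
      fun M hM => ?_
    · rw [card_univ, card_univ, Fintype.card_fin, Fintype.card_fin]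
      refine Nat.mul_le_mul (by omega) ?_
      unfold columnBudget
      omega
    · have : HasCopy F M univ univ := by
        by_contra hno
        exact not_mem_freeness_of_isFar hm hn hε0 hM (mem_freeness_of_not_hasCopy hno)
      simp only [this, not_true_eq_false]
      rw [unifProb_eq]
      simp
  · refine exists_test hrow (Ω := (Fin (letterSize k e (rowThreshold k e)) → Fin n) ×
      (Fin (hitSize k e (rowThreshold k e)) → Fin n)) (fun _ => univ)
      (fun y => univ.image y.1 ∪ univ.image y.2) (fun y => ?_) fun M hM => ?_
    · have c1 := card_union_le (univ.image y.1) (univ.image y.2)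
      have := card_image_univ_le y.1
      have := card_image_univ_le y.2
      rw [card_univ, Fintype.card_fin]
      refine Nat.mul_le_mul (by omega) ?_
      unfold columnBudget
      omega
    · have h := unifProb_not_columnsGood_le hk hF hk0 M x ∅ hn he rfl rfl hnk rfl (by simp)
      refine (unifProb_mono fun y hno => ⟨fun hc => hno ?_, fun hc => hno ?_⟩).trans
        (h.trans (by norm_num))
      · exact hc.mono (subset_univ _) subset_union_left
      · exact hasCopy_of_isFar hk hm hn hε hM (rowsGood_univ M x hx) (hc.mono subset_union_right)

theorem exists_sizesLE (hfin : F.Finite) : ∃ k, 0 < k ∧ SizesLE F k := by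
  refine ⟨hfin.toFinset.sup (fun A => A.1 + A.2.1) + 1, Nat.succ_pos _, fun A hA => ?_⟩
  have := le_sup (f := fun A : FinMatrix (Fin 2) => A.1 + A.2.1) (hfin.mem_toFinset.2 hA)
  constructor <;> omega

end Main

end FinMatrix

open FinMatrix in
theorem mainTheorem3 (P : Set (FinMatrix (Fin 2))) (hP : FinMatrix.Hereditary P)
    (F : Set (FinMatrix (Fin 2))) (hfin : F.Finite)
    (hrow : FinMatrix.ClosedUnderRowPermutations F) (hPF : P = FinMatrix.freeness F) :
    FinMatrix.EasilyTestable P := by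
  subst hPF
  obtain ⟨k, hk0, hk⟩ := exists_sizesLE hfin
  obtain ⟨p, hp⟩ := (IsPolynomialFun.queryBudget k).exists_real_polynomial
  refine ⟨p, fun ε hε => ?_⟩
  have he : 0 < ⌈ε⁻¹⌉₊ := Nat.ceil_pos.2 (by positivity)
  have heε : 1 ≤ (⌈ε⁻¹⌉₊ : ℝ) * ε := by
    have := mul_le_mul_of_nonneg_right (Nat.le_ceil ε⁻¹) hε.le
    rwa [inv_mul_cancel₀ hε.ne'] at this
  have hT := fun (m n : ℕ) (hmn : 0 < m ∧ 0 < n) =>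
    exists_test_queryBudget hk hk0 hrow hmn.1 hmn.2 he hε heε
  choose T hT hq using hT
  -- Empty matrices are accepted without queries; only the query bound concerns them.
  refine ⟨fun m n => if h : 0 < m ∧ 0 < n then T m n h else PMF.pure (.halt true),
    fun m n hm hn M => ?_, fun m n hm hn M hM => ?_, fun m n M t ht => ?_⟩
  · have h : 0 < m ∧ 0 < n := ⟨hm, hn⟩
    simp only [RandQueryAlg.outputProb, h, and_self, dif_pos]
    exact ⟨fun hM => ((hT m n h M).1 hM).2, (hT m n h M).2⟩
  · have h : 0 < m ∧ 0 < n := ⟨hm, hn⟩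
    simp only [RandQueryAlg.outputProb, h, and_self, dif_pos]
    exact ((hT m n h M).1 hM).1
  · refine le_trans ?_ (hp ε⁻¹ (by positivity))
    by_cases h : 0 < m ∧ 0 < n
    · simp only [h, and_self, dif_pos] at ht
      exact_mod_cast hq m n h M t ht
    · simp only [h, dif_neg, not_false_eq_true, PMF.support_pure, Set.mem_singleton_iff] at ht
      subst ht
      simp [QueryAlg.queries]
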